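/- **Theorem.** Fix $\rho>1$, $R>0$, $\epsilon>0$. Let $\mathcal W$ be the Banach space of functions $f(\lambda)=\sum_{i\in\mathbb Z}c_i\lambda^i$ on the unit circle with $\|f\|=\sum_i|c_i|\rho^{|i|}<\infty$, let $\mathcal W^{\ge 0}$ be the subspace of those with $c_i=0$ for all $i<0$, and write $f^0=c_0$. Let $\mathbb D_\rho=\{|\lambda|<\rho\}$ and $\mathbb A_{\rho}=\{\rho^{-1}<|\lambda|<\rho\}$. Let $D^*(\infty,R)=\{z\in\mathbb C:|z|>R^{-1}\}$, let $\widetilde{D^*}(\infty,R)$ be its universal cover, with a base point $\widetilde z_0$, and let $\sigma$ be the generator of its group of deck transformations corresponding to one positive turn around $0$. Let $$\xi_t=\begin{pmatrix}\alpha_t&\lambda^{-1}\beta_t\\ \gamma_t&-\alpha_t\end{pmatrix},\qquad t\in(-\epsilon,\epsilon),$$ be a $C^1$ family of DPW potentials on $D^*(\infty,R)$: the 1-forms $\alpha_t,\beta_t,\gamma_t$ on $D^*(\infty,R)$ have values in $\mathcal W^{\ge0}$, are holomorphic in $z$, and are of class $C^1$ in $(t,z)$ as $\mathcal W$-valued maps.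 Assume that at $z=\infty$ the 1-forms $\alpha_t$ and $\beta_t$ have at most a simple pole and $\gamma_t$ has at most a double pole, for every $t$ (that is, $\xi_t$ has a pole of multiplicity at most $\begin{pmatrix}1&1\\2&1\end{pmatrix}$), and that $\xi_0=\begin{pmatrix}0&0\\1&0\end{pmatrix}dz$. Let $\Phi_t$, $t\in(-\epsilon,\epsilon)$, be a family of solutions of $d\Phi_t=\Phi_t\xi_t$ on $\widetilde{D^*}(\infty,R)$ with values in $SL(2,\mathcal W)$, of class $C^1$ in $(t,z)$, such that $\Phi_0(\widetilde z_0,\cdot)$ extends holomorphically to the annulus $\mathbb A_{\rho'}$ for some $\rho'>\rho$. Assume that for all $t\in(-\epsilon,\epsilon)$: 1. $\Phi_t$ solves the Monodromy Problem with respect to $\sigma$: the monodromy $\mathcal M_t(\lambda)=\Phi_t(\sigma(z),\lambda)\Phi_t(z,\lambda)^{-1}$ (which does not depend on $z$) satisfies $\mathcal M_t(\lambda)\in SU(2)$ for $|\lambda|=1$, $\mathcal M_t(1)=\pm I_2$ and $\frac{\partial \mathcal M_t}{\partial\lambda}(1)=0$; 2. $\operatorname{Res}_\infty\beta_t^0=0$;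 3. $\operatorname{Re}\left(\operatorname{Res}_\infty(z\beta_t^0)\right)=0$. Then for all $t$ small enough, there exists a gauge $G_t$ on $D^*(\infty,R)$, i.e. a map $(z,\lambda)\mapsto G_t(z,\lambda)\in SL(2,\mathbb C)$ holomorphic in $z\in D^*(\infty,R)$ and $\lambda\in\mathbb D_\rho$ with $G_t(z,0)$ upper triangular, such that the gauged potential $\xi_t\cdot G_t=G_t^{-1}\xi_tG_t+G_t^{-1}dG_t$ extends holomorphically at $\infty$ as a DPW potential: near $z=\infty$ it is of the form $\begin{pmatrix}\widehat\alpha&\lambda^{-1}\widehat\beta\\ \widehat\gamma&-\widehat\alpha\end{pmatrix}$ with 1-forms $\widehat\alpha,\widehat\beta,\widehat\gamma$ holomorphic in $z$, including at $z=\infty$, and in $\lambda\in\mathbb D_\rho$. In other words, $\infty$ is a removable singularity of $\xi_t$. -/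

import Mathlib

open Set Filter Topology

noncomputable section

/-- The Banach space `𝓦` (for a fixed `ρ > 1`) of functions `∑ cᵢ λ^i` on the unit circle with
norm `∑ |cᵢ| ρ^|i| < ∞`.  An element is stored through its weighted Fourier coefficients
`i ↦ cᵢ ρ^|i|`, which form an arbitrary element of `ℓ¹(ℤ, ℂ)`; the norm is the `ℓ¹` norm. -/
def Wiener (_ρ : ℝ) : Type := lp (fun _ : ℤ => ℂ) 1

namespace Wiener

variable {ρ : ℝ}

instance : NormedAddCommGroup (Wiener ρ) :=
  inferInstanceAs (NormedAddCommGroup (lp (fun _ : ℤ => ℂ) 1))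

instance : NormedSpace ℂ (Wiener ρ) :=
  inferInstanceAs (NormedSpace ℂ (lp (fun _ : ℤ => ℂ) 1))

instance : CompleteSpace (Wiener ρ) :=
  inferInstanceAs (CompleteSpace (lp (fun _ : ℤ => ℂ) 1))

/-- The weighted Fourier coefficients `cᵢ ρ^|i|`. -/
def weighted (f : Wiener ρ) : ℤ → ℂ := (show lp (fun _ : ℤ => ℂ) 1 from f).1

/-- The Fourier coefficient `cᵢ` of `f`. -/
def coeff (f : Wiener ρ) (i : ℤ) : ℂ := f.weighted i / (ρ : ℂ) ^ i.natAbs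

/-- The value `f(λ) = ∑ cᵢ λ^i`; the series converges for `ρ⁻¹ ≤ |λ| ≤ ρ`, and for all
`|λ| ≤ ρ` if `f ∈ 𝓦^{≥0}`. -/
def eval (f : Wiener ρ) (l : ℂ) : ℂ := ∑' i : ℤ, f.coeff i * l ^ i

/-- `f ∈ 𝓦^{≥0}`: all Fourier coefficients with negative index vanish. -/
def IsNonneg (f : Wiener ρ) : Prop := ∀ i : ℤ, i < 0 → f.coeff i = 0

theorem norm_coeff_mul (hρ : 1 < ρ) (f : Wiener ρ) (i : ℤ) :
    ‖f.coeff i‖ * ρ ^ i.natAbs = ‖f.weighted i‖ := by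
  have h0 : (0 : ℝ) < ρ ^ i.natAbs := pow_pos (by linarith) _
  rw [coeff, norm_div, norm_pow, Complex.norm_real, Real.norm_of_nonneg (by linarith : 0 ≤ ρ)]
  field_simp

/-- The norm of `𝓦` is `∑ |cᵢ| ρ^|i|`. -/
theorem norm_eq (hρ : 1 < ρ) (f : Wiener ρ) :
    ‖f‖ = ∑' i : ℤ, ‖f.coeff i‖ * ρ ^ i.natAbs := by
  have h := lp.norm_eq_tsum_rpow (p := 1) (by simp) (show lp (fun _ : ℤ => ℂ) 1 from f)
  simp only [ENNReal.toReal_one, Real.rpow_one, div_one] at h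
  simp only [norm_coeff_mul hρ]
  exact h

/-- The elements of `𝓦` correspond exactly to the Fourier series with `∑ |cᵢ| ρ^|i| < ∞`. -/
theorem existsUnique_coeff (hρ : 1 < ρ) (c : ℤ → ℂ) :
    (Summable fun i : ℤ => ‖c i‖ * ρ ^ i.natAbs) ↔ ∃! f : Wiener ρ, f.coeff = c := by
  have hρ0 : ∀ n : ℕ, (ρ : ℂ) ^ n ≠ 0 := fun n =>
    pow_ne_zero _ (by exact_mod_cast (by linarith : ρ ≠ 0))
  have habs : ‖(ρ : ℂ)‖ = ρ := by
    rw [Complex.norm_real, Real.norm_of_nonneg (by linarith : 0 ≤ ρ)]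
  constructor
  · intro h
    have hm : Memℓp (fun i : ℤ => c i * (ρ : ℂ) ^ i.natAbs) 1 := by
      apply memℓp_gen
      simpa [norm_mul, norm_pow, abs_of_pos (by linarith : 0 < ρ)] using h
    refine ⟨(⟨_, hm⟩ : lp (fun _ : ℤ => ℂ) 1), ?_, ?_⟩
    · funext i
      exact mul_div_cancel_right₀ (c i) (hρ0 _)
    · intro g hg
      apply Subtype.ext
      funext i
      have h1 : g.coeff i = c i := congrFun hg i
      rw [coeff, div_eq_iff (hρ0 _)] at h1
      exact h1
  · rintro ⟨f, rfl, -⟩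
    have h := (lp.memℓp (show lp (fun _ : ℤ => ℂ) 1 from f)).summable (by simp)
    simp only [ENNReal.toReal_one, Real.rpow_one] at h
    simp only [norm_coeff_mul hρ]
    exact h

/-- Entrywise evaluation at `λ` of a matrix with entries in `𝓦`. -/
def evalMatrix (M : Matrix (Fin 2) (Fin 2) (Wiener ρ)) (l : ℂ) : Matrix (Fin 2) (Fin 2) ℂ :=
  Matrix.of fun i j => (M i j).eval l

end Wiener

/-- The open annulus `𝔸_ρ = {ρ⁻¹ < |λ| < ρ}` in the `λ`-plane. -/
def loopAnnulus (ρ : ℝ) : Set ℂ := {l | ρ⁻¹ < ‖l‖ ∧ ‖l‖ < ρ}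

/-- The punctured neighbourhood `D^*(∞, R) = {|z| > R⁻¹}` of `∞`. -/
def puncturedDiscInfty (R : ℝ) : Set ℂ := {z | R⁻¹ < ‖z‖}

/-- The universal cover of `D^*(∞, R)`: the half plane `{Re ζ > -log R}`, with covering map
`ζ ↦ exp ζ`.  Its deck group is generated by `σ(ζ) = ζ + 2πi`. -/
def coverInfty (R : ℝ) : Set ℂ := {ζ | -Real.log R < ζ.re}

theorem exp_image_coverInfty {R : ℝ} (hR : 0 < R) :
    Complex.exp '' coverInfty R = puncturedDiscInfty R := by
  ext z
  simp only [coverInfty, puncturedDiscInfty, mem_image, mem_ofPred_eq]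
  constructor
  · rintro ⟨ζ, h, rfl⟩
    rw [Complex.norm_exp, ← Real.exp_log hR, ← Real.exp_neg]
    exact Real.exp_lt_exp.2 h
  · intro h
    have hz : 0 < ‖z‖ := (inv_pos.2 hR).trans h
    refine ⟨Complex.log z, ?_, Complex.exp_log (norm_pos_iff.1 hz)⟩
    rw [Complex.log_re, ← Real.log_inv]
    exact Real.log_lt_log (inv_pos.2 hR) h

/-- The generator `σ` of the deck group of the universal cover of `D^*(∞, R)`. -/
def deckGen (ζ : ℂ) : ℂ := ζ + 2 * Real.pi * Complex.I

/-- The matrix `(α, λ⁻¹β; γ, -α)` at `λ`, for given `α, β, γ` in `𝓦`. -/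
def loopMatrix {ρ : ℝ} (a b c : Wiener ρ) (l : ℂ) : Matrix (Fin 2) (Fin 2) ℂ :=
  !![a.eval l, l⁻¹ * b.eval l; c.eval l, -a.eval l]

/-- `ξ_t = (α_t, λ⁻¹β_t; γ_t, -α_t) dz`, `t ∈ (-ε, ε)`, is a `C¹` family of DPW potentials on `S`.
The 1-forms are given by their coefficients with respect to `dz`. -/
structure IsC1PotentialFamily {ρ : ℝ} (ε : ℝ) (S : Set ℂ) (α β γ : ℝ → ℂ → Wiener ρ) : Prop where
  contDiff_α : ContDiffOn ℝ 1 (fun p : ℝ × ℂ => α p.1 p.2) (Ioo (-ε) ε ×ˢ S)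
  contDiff_β : ContDiffOn ℝ 1 (fun p : ℝ × ℂ => β p.1 p.2) (Ioo (-ε) ε ×ˢ S)
  contDiff_γ : ContDiffOn ℝ 1 (fun p : ℝ × ℂ => γ p.1 p.2) (Ioo (-ε) ε ×ˢ S)
  holomorphic_α : ∀ t ∈ Ioo (-ε) ε, DifferentiableOn ℂ (α t) S
  holomorphic_β : ∀ t ∈ Ioo (-ε) ε, DifferentiableOn ℂ (β t) S
  holomorphic_γ : ∀ t ∈ Ioo (-ε) ε, DifferentiableOn ℂ (γ t) S
  nonneg_α : ∀ t ∈ Ioo (-ε) ε, ∀ z ∈ S, (α t z).IsNonneg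
  nonneg_β : ∀ t ∈ Ioo (-ε) ε, ∀ z ∈ S, (β t z).IsNonneg
  nonneg_γ : ∀ t ∈ Ioo (-ε) ε, ∀ z ∈ S, (γ t z).IsNonneg

/-- The coefficient, with respect to `dw` in the coordinate `w = 1/z` at `∞`, of the 1-form
`f(z) dz`. -/
def coeffAtInfty {E : Type*} [AddCommGroup E] [Module ℂ E] (f : ℂ → E) (w : ℂ) : E :=
  (-(w ^ 2)⁻¹) • f w⁻¹

/-- The 1-form `f(z) dz` has at `∞` a pole of multiplicity at most `n` (or none). -/
def HasPoleAtInftyLE {E : Type*} [NormedAddCommGroup E] [NormedSpace ℂ E] (n : ℕ) (f : ℂ → E) :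
    Prop :=
  MeromorphicAt (coeffAtInfty f) 0 ∧ ((-(n : ℤ) : ℤ) : WithTop ℤ) ≤
    meromorphicOrderAt (coeffAtInfty f) 0

/-- `Res_∞ (f(z) dz) = -(2πi)⁻¹ ∮_{|z| = r} f(z) dz` for large `r` (for `f` holomorphic near `∞`
the right-hand side does not depend on `r`). -/
def resInfty (f : ℂ → ℂ) : ℂ :=
  limUnder atTop fun r : ℝ => -(2 * Real.pi * Complex.I)⁻¹ * ∮ z in C(0, r), f z

/-- `Φ_t`, `t ∈ (-ε, ε)`, is a `C¹` family of `SL(2, 𝓦)`-valued solutions of `dΦ_t = Φ_t ξ_t` on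
the universal cover of `D^*(∞, R)`, where `ξ_t = (α_t, λ⁻¹β_t; γ_t, -α_t) dz` is pulled back
by `z = exp ζ`. -/
structure IsC1SolutionFamily {ρ : ℝ} (ε R : ℝ) (α β γ : ℝ → ℂ → Wiener ρ)
    (Φ : ℝ → ℂ → Matrix (Fin 2) (Fin 2) (Wiener ρ)) : Prop where
  contDiff : ∀ i j, ContDiffOn ℝ 1 (fun p : ℝ × ℂ => Φ p.1 p.2 i j)
    (Ioo (-ε) ε ×ˢ coverInfty R)
  det_eq_one : ∀ t ∈ Ioo (-ε) ε, ∀ ζ ∈ coverInfty R, ∀ l ∈ loopAnnulus ρ,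
    (Wiener.evalMatrix (Φ t ζ) l).det = 1
  hasDerivAt : ∀ t ∈ Ioo (-ε) ε, ∀ ζ ∈ coverInfty R, ∀ l ∈ loopAnnulus ρ, ∀ i j,
    HasDerivAt (fun ζ' => (Φ t ζ' i j).eval l)
      ((Wiener.evalMatrix (Φ t ζ) l *
        loopMatrix (α t (Complex.exp ζ)) (β t (Complex.exp ζ)) (γ t (Complex.exp ζ)) l) i j *
        Complex.exp ζ) ζ

/-- The monodromy `𝓜(Φ, σ)(λ) = Φ(σ(ζ), λ) Φ(ζ, λ)⁻¹`. -/
def monodromy {ρ : ℝ} (Φ : ℂ → Matrix (Fin 2) (Fin 2) (Wiener ρ)) (ζ l : ℂ) :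
    Matrix (Fin 2) (Fin 2) ℂ :=
  Wiener.evalMatrix (Φ (deckGen ζ)) l * (Wiener.evalMatrix (Φ ζ) l)⁻¹

/-- The Monodromy Problem for `Φ` with respect to `σ`; the monodromy, which does not depend on the
point of the universal cover, is computed at `ζ`. -/
structure SolvesMonodromyProblem {ρ : ℝ} (Φ : ℂ → Matrix (Fin 2) (Fin 2) (Wiener ρ)) (ζ : ℂ) :
    Prop where
  unitary : ∀ l : ℂ, ‖l‖ = 1 → monodromy Φ ζ l ∈ Matrix.specialUnitaryGroup (Fin 2) ℂ
  at_one : monodromy Φ ζ 1 = 1 ∨ monodromy Φ ζ 1 = -1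
  deriv_at_one : ∀ i j, HasDerivAt (fun l => monodromy Φ ζ l i j) 0 1

/-- `G(z, λ)` is a gauge on `S`: it is holomorphic in `z ∈ S` and `λ ∈ 𝔻_ρ`, has determinant `1`,
and `G(z, 0)` is upper triangular. -/
structure IsGauge (ρ : ℝ) (S : Set ℂ) (G : ℂ → ℂ → Matrix (Fin 2) (Fin 2) ℂ) : Prop where
  holomorphic : ∀ i j, DifferentiableOn ℂ (fun p : ℂ × ℂ => G p.1 p.2 i j)
    (S ×ˢ Metric.ball 0 ρ)
  det_eq_one : ∀ z ∈ S, ∀ l ∈ Metric.ball (0 : ℂ) ρ, (G z l).det = 1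
  upper : ∀ z ∈ S, G z 0 1 0 = 0

/-- The gauged potential `ξ·G = G⁻¹ ξ G + G⁻¹ dG` (coefficient with respect to `dz`). -/
def gaugeAction (ξ G : ℂ → ℂ → Matrix (Fin 2) (Fin 2) ℂ) (z l : ℂ) :
    Matrix (Fin 2) (Fin 2) ℂ :=
  (G z l)⁻¹ * ξ z l * G z l + (G z l)⁻¹ * Matrix.of fun i j => deriv (fun z' => G z' l i j) z

/-- The potential `ξ(z, λ) dz` extends holomorphically at `∞` as a DPW potential: near `w = 0`, in
the coordinate `w = 1/z`, it is `(a, λ⁻¹b; c, -a) dw` with `a, b, c` holomorphic in `w`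
(including `w = 0`) and `λ ∈ 𝔻_ρ`. -/
def ExtendsHolomorphicallyAtInfty (ρ : ℝ) (ξ : ℂ → ℂ → Matrix (Fin 2) (Fin 2) ℂ) : Prop :=
  ∃ r : ℝ, 0 < r ∧ ∃ a b c : ℂ × ℂ → ℂ,
    DifferentiableOn ℂ a (Metric.ball 0 r ×ˢ Metric.ball 0 ρ) ∧
    DifferentiableOn ℂ b (Metric.ball 0 r ×ˢ Metric.ball 0 ρ) ∧
    DifferentiableOn ℂ c (Metric.ball 0 r ×ˢ Metric.ball 0 ρ) ∧
    ∀ w ∈ Metric.ball (0 : ℂ) r, w ≠ 0 → ∀ l ∈ Metric.ball (0 : ℂ) ρ, l ≠ 0 →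
      coeffAtInfty (fun z => ξ z l) w =
        !![a (w, l), l⁻¹ * b (w, l); c (w, l), -a (w, l)]

end

/-! In the coordinate `w = 1/z`, apply the gauge `(w, g; 0, w⁻¹)` with `g = (a₀ - 1)/c₀`, chosen to
cancel the diagonal pole. Only the upper right entry can then be singular at `w = 0`, with three
polar coefficients `(X, Y, Z) = λ⁻¹ (x, y, z)`, where `x, y, z` are holomorphic in `λ ∈ 𝔻_ρ`. It
suffices to show that `x = y = z = 0` for small `t`; see `exists_gauge_of_polar_eq_zero`.

The monodromy detects these coefficients. In a further frame the unperturbed potential vanishes, and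
the perturbed one is a small regular part plus a polar part linear in `X, Y, Z`. The regular part
has a single-valued fundamental solution near `w = 0`, hence drops out by conjugation. Up to
conjugation by bounded matrices the monodromy is therefore `1 + 2πi (Y, Z; -X, -Y)`, with an error
small relative to `q = |X| + |Y| + |Z|`. The trace-free part of a matrix in `SU(2)` has a
determinant comparable to the square of its norm, while the first-order term has determinant `4π²
(Y² - XZ)`. Hence, on the unit circle, `q² ≤ C Re (Y² - XZ)`, and `q` is at most a constant times
the trace-free part of the monodromy, which is `o(λ - 1)` at `1`. This is
`polarNorm_sq_le_of_monodromy`, resting on `coercive_of_conj_mem_specialUnitaryGroup`. The constants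
are uniform in `t` and `λ`.

These estimates force vanishing (`eqOn_zero_of_quadratic_coercive`). Write `(x, y, z) = (λ - 1)² (u,
v, w)`. Since `λ⁻¹ (λ - 1)² = -|λ - 1|²` on the circle, `F = v² - u w` inherits the estimate, so `Re
F ≥ 0` there. The residue conditions give `x(0) = 0` and `y(0) ∈ iℝ`, so `Re F(0) = Re y(0)² ≤ 0`.
By the maximum principle `Re F = 0` on the circle, and coercivity yields `u = v = w = 0`. -/

noncomputable section

/-! ### Evaluation functionals on the Wiener space -/

namespace Wiener

variable {ρ : ℝ}

theorem hasSum_norm_weighted (f : Wiener ρ) : HasSum (fun i => ‖f.weighted i‖) ‖f‖ := by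
  have h := lp.hasSum_norm (p := 1) (by simp) (show lp (fun _ : ℤ => ℂ) 1 from f)
  simp only [ENNReal.toReal_one, Real.rpow_one] at h
  exact h

theorem norm_weighted_le (f : Wiener ρ) (i : ℤ) : ‖f.weighted i‖ ≤ ‖f‖ :=
  le_hasSum f.hasSum_norm_weighted i fun _ _ => norm_nonneg _

/-- The Fourier coefficient as a continuous linear functional. -/
def coeffCLM (ρ : ℝ) (i : ℤ) : Wiener ρ →L[ℂ] ℂ :=
  LinearMap.mkContinuous
    { toFun := fun f => f.coeff i
      map_add' := fun f g => add_div (f.weighted i) (g.weighted i) _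
      map_smul' := fun c f => mul_div_assoc c (f.weighted i) _ }
    (‖(ρ : ℂ) ^ i.natAbs‖⁻¹) fun f => by
      change ‖f.weighted i / _‖ ≤ _
      rw [norm_div, div_eq_inv_mul]
      exact mul_le_mul_of_nonneg_left (f.norm_weighted_le i) (by positivity)

theorem norm_coeffCLM_le (hρ : 1 < ρ) (i : ℤ) : ‖coeffCLM ρ i‖ ≤ (ρ ^ i.natAbs)⁻¹ := by
  refine (LinearMap.mkContinuous_norm_le _ (by positivity) _).trans_eq ?_
  rw [norm_pow, Complex.norm_real, Real.norm_of_nonneg (by linarith)]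

/-- Evaluation at `l ∈ 𝔻_ρ` of the part of a Fourier series with nonnegative indices. -/
def evalNonneg (ρ : ℝ) (l : ℂ) : Wiener ρ →L[ℂ] ℂ := ∑' n : ℕ, l ^ n • coeffCLM ρ n

theorem norm_pow_smul_coeffCLM_le (hρ : 1 < ρ) {l : ℂ} {s : ℝ} (hl : ‖l‖ ≤ s) (n : ℕ) :
    ‖l ^ n • coeffCLM ρ n‖ ≤ (s / ρ) ^ n := by
  rw [norm_smul, norm_pow, div_pow, div_eq_mul_inv]
  exact mul_le_mul (by gcongr) (norm_coeffCLM_le hρ n) (norm_nonneg _)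
    (pow_nonneg ((norm_nonneg l).trans hl) n)

theorem summable_pow_smul_coeffCLM (hρ : 1 < ρ) {l : ℂ} (hl : ‖l‖ < ρ) :
    Summable fun n : ℕ => l ^ n • coeffCLM ρ n := by
  refine Summable.of_norm_bounded (g := fun n => (‖l‖ / ρ) ^ n) ?_
    fun n => norm_pow_smul_coeffCLM_le hρ le_rfl n
  exact summable_geometric_of_lt_one (by positivity) ((div_lt_one (by linarith)).2 hl)

/-- Holomorphy holds in operator norm, by comparison with a geometric series of ratio `s / ρ` on
each smaller disc. Applied to a holomorphic `𝓦`-valued function of `w`, this yields joint holomorphy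
in `(w, λ)`. -/
theorem differentiableOn_evalNonneg (hρ : 1 < ρ) :
    DifferentiableOn ℂ (evalNonneg ρ) (Metric.ball 0 ρ) := by
  intro l hl
  have hl' : ‖l‖ < ρ := by simpa using hl
  obtain ⟨s, hs, hsρ⟩ := exists_between hl'
  have hs0 : 0 ≤ s := (norm_nonneg l).trans hs.le
  have h : DifferentiableOn ℂ (fun l : ℂ => ∑' n : ℕ, l ^ n • coeffCLM ρ n) (Metric.ball 0 s) := by
    refine Complex.differentiableOn_tsum_of_summable_norm (u := fun n => (s / ρ) ^ n)
      (summable_geometric_of_lt_one (by positivity) ((div_lt_one (by linarith)).2 hsρ))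
      (fun n => by fun_prop) Metric.isOpen_ball fun n l hl =>
        norm_pow_smul_coeffCLM_le hρ (mem_ball_zero_iff.1 hl).le n
  exact (h.differentiableAt (Metric.isOpen_ball.mem_nhds (by simpa using hs))).differentiableWithinAt

theorem evalNonneg_apply (hρ : 1 < ρ) {l : ℂ} (hl : ‖l‖ < ρ) (f : Wiener ρ) :
    evalNonneg ρ l f = ∑' n : ℕ, l ^ n * f.coeff n := by
  have h := (summable_pow_smul_coeffCLM hρ hl).hasSum.mapL
    (ContinuousLinearMap.apply ℂ ℂ f)
  exact h.tsum_eq.symm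

theorem evalNonneg_zero (hρ : 1 < ρ) (f : Wiener ρ) : evalNonneg ρ 0 f = f.coeff 0 := by
  rw [evalNonneg_apply hρ (by simpa using (by linarith : 0 < ρ)), tsum_eq_single 0]
  · simp
  · intro n hn
    simp [hn]

/-- The weights `ρ^n` dominate `|λ|^n`. Smallness in `𝓦` thus becomes smallness uniform in `λ ∈
𝔻_ρ`. -/
theorem norm_evalNonneg_apply_le (hρ : 1 < ρ) {l : ℂ} (hl : ‖l‖ < ρ) (f : Wiener ρ) :
    ‖evalNonneg ρ l f‖ ≤ ‖f‖ := by
  rw [evalNonneg_apply hρ hl]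
  have hs : Summable fun n : ℕ => ‖f.weighted n‖ :=
    f.hasSum_norm_weighted.summable.comp_injective Nat.cast_injective
  have hle : ∀ n : ℕ, ‖l ^ n * f.coeff n‖ ≤ ‖f.weighted n‖ := by
    intro n
    rw [← norm_coeff_mul hρ, norm_mul, norm_pow, mul_comm]
    simp only [Int.natAbs_natCast]
    gcongr
  refine (tsum_of_norm_bounded hs.hasSum hle).trans ?_
  rw [← f.hasSum_norm_weighted.tsum_eq]
  exact tsum_comp_le_tsum_of_inj f.hasSum_norm_weighted.summable (fun _ => norm_nonneg _)
    Nat.cast_injective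

theorem IsNonneg.eval_eq (hρ : 1 < ρ) {f : Wiener ρ} (hf : f.IsNonneg) {l : ℂ} (hl : ‖l‖ < ρ) :
    f.eval l = evalNonneg ρ l f := by
  rw [evalNonneg_apply hρ hl, eval]
  have hinj : Function.Injective ((↑) : ℕ → ℤ) := Nat.cast_injective
  rw [← hinj.tsum_eq (f := fun i : ℤ => f.coeff i * l ^ i)]
  · simp [mul_comm]
  · intro i hi
    by_contra h
    have hi' : i < 0 := by
      by_contra h0
      exact h ⟨i.toNat, Int.toNat_of_nonneg (not_lt.1 h0)⟩
    simp [hf i hi'] at hi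

theorem norm_eval_le (hρ : 1 < ρ) (f : Wiener ρ) {l : ℂ} (hl : ‖l‖ = 1) : ‖f.eval l‖ ≤ ‖f‖ := by
  refine tsum_of_norm_bounded f.hasSum_norm_weighted fun i => ?_
  rw [← norm_coeff_mul hρ, norm_mul, norm_zpow, hl, one_zpow]
  exact mul_le_mul_of_nonneg_left (one_le_pow₀ hρ.le) (norm_nonneg _)

end Wiener

/-! ### Poles, Taylor quotients and residues at infinity -/

section HolomorphicExtension

variable {E : Type*} [NormedAddCommGroup E] [NormedSpace ℂ E]

/-- Maximum principle. Continuity in `t` gives smallness only on a circle away from `∞`; this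
carries it across the singularity. -/
theorem norm_le_of_norm_le_sphere {f : ℂ → E} {R r δ : ℝ} (hr : 0 < r) (hrR : r < R)
    (hf : DifferentiableOn ℂ f (Metric.ball 0 R))
    (hδ : ∀ w ∈ Metric.sphere (0 : ℂ) r, ‖f w‖ ≤ δ) {w : ℂ} (hw : w ∈ Metric.closedBall (0 : ℂ) r) :
    ‖f w‖ ≤ δ := by
  have hd : DiffContOnCl ℂ f (Metric.ball 0 r) :=
    hf.diffContOnCl_ball (Metric.closedBall_subset_ball hrR)
  refine Complex.norm_le_of_forall_mem_frontier_norm_le Metric.isBounded_ball hd ?_ ?_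
  · rw [frontier_ball _ hr.ne']; exact hδ
  · rwa [closure_ball _ hr.ne']

theorem eq_add_smul_dslope (f : ℂ → E) (w : ℂ) : f w = f 0 + w • dslope f 0 w := by
  have := sub_smul_dslope f 0 w
  rw [sub_zero] at this
  rw [this]; abel

variable [CompleteSpace E]

theorem exists_differentiableOn_extension {F : ℂ → E} {R : ℝ} (hR : 0 < R)
    (hF : DifferentiableOn ℂ F (Metric.ball 0 R \ {0})) (hm : MeromorphicAt F 0)
    (ho : 0 ≤ meromorphicOrderAt F 0) :
    ∃ A : ℂ → E, DifferentiableOn ℂ A (Metric.ball 0 R) ∧ ∀ w ≠ 0, A w = F w := by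
  obtain ⟨c, hc⟩ := tendsto_nhds_of_meromorphicOrderAt_nonneg hm ho
  refine ⟨Function.update F 0 c, ?_, fun w hw => Function.update_of_ne hw _ _⟩
  refine (Complex.differentiableOn_compl_singleton_and_continuousAt_iff
    (Metric.ball_mem_nhds 0 hR)).1 ⟨?_, continuousAt_update_same.2 hc⟩
  exact hF.congr fun w hw => Function.update_of_ne hw.2 _ _

theorem inv_mem_puncturedDiscInfty {R : ℝ} {w : ℂ} (hw : w ∈ Metric.ball (0 : ℂ) R)
    (hw0 : w ≠ 0) : w⁻¹ ∈ puncturedDiscInfty R := by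
  have h1 : ‖w‖ < R := mem_ball_zero_iff.1 hw
  have h2 : 0 < ‖w‖ := norm_pos_iff.2 hw0
  simp only [puncturedDiscInfty, mem_ofPred_eq, norm_inv]
  exact inv_strictAnti₀ h2 h1

/-- A 1-form with a pole of multiplicity at most `n ≤ 2` at `∞` is `w^(2-n) A(w) dz` with `A`
holomorphic at `w = 1/z = 0`. -/
theorem HasPoleAtInftyLE.exists_eq_smul {n : ℕ} (hn : n ≤ 2) {f : ℂ → E} {R : ℝ} (hR : 0 < R)
    (hf : DifferentiableOn ℂ f (puncturedDiscInfty R)) (hp : HasPoleAtInftyLE n f) :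
    ∃ A : ℂ → E, DifferentiableOn ℂ A (Metric.ball 0 R) ∧
      ∀ w ≠ 0, f w⁻¹ = w ^ (2 - n) • A w := by
  obtain ⟨hm, ho⟩ := hp
  have hF : DifferentiableOn ℂ (fun w : ℂ => w ^ n • coeffAtInfty f w)
      (Metric.ball 0 R \ {0}) := by
    intro w hw
    have hw0 : w ≠ 0 := hw.2
    refine DifferentiableWithinAt.smul (by fun_prop) (DifferentiableWithinAt.smul ?_ ?_)
    · exact ((differentiableAt_id.pow 2).inv (pow_ne_zero 2 hw0)).neg.differentiableWithinAt
    · exact (hf _ (inv_mem_puncturedDiscInfty hw.1 hw0)).comp w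
        (differentiableAt_inv hw0).differentiableWithinAt
        fun v hv => inv_mem_puncturedDiscInfty hv.1 hv.2
  have hpow : MeromorphicAt (fun w : ℂ => w ^ n) 0 := by fun_prop
  have hord : meromorphicOrderAt (fun w : ℂ => w ^ n) 0 = ((n : ℤ) : WithTop ℤ) := by
    simpa using fun_meromorphicOrderAt_pow_id_sub_const (𝕜 := ℂ) (x := 0) (n := n)
  obtain ⟨A, hA, hAF⟩ := exists_differentiableOn_extension hR hF (hpow.smul hm) (by
    rw [fun_meromorphicOrderAt_smul hpow hm, hord]
    have h1 : ((n : ℤ) : WithTop ℤ) + ((-(n : ℤ) : ℤ) : WithTop ℤ) = 0 := by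
      rw [← WithTop.coe_add]; simp
    rw [← h1]
    gcongr)
  refine ⟨fun w => -A w, hA.neg, fun w hw => ?_⟩
  have h2 : w ^ (2 - n) * w ^ n = w ^ 2 := by rw [← pow_add]; congr 1; omega
  change _ = w ^ (2 - n) • -A w
  rw [hAF w hw, coeffAtInfty, ← smul_neg, ← neg_smul, neg_neg, smul_smul, smul_smul, h2,
     mul_inv_cancel₀ (pow_ne_zero 2 hw), one_smul]

theorem DifferentiableOn.dslope_zero {f : ℂ → E} {R : ℝ} (hR : 0 < R)
    (hf : DifferentiableOn ℂ f (Metric.ball 0 R)) :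
    DifferentiableOn ℂ (dslope f 0) (Metric.ball 0 R) :=
  (Complex.differentiableOn_dslope (Metric.ball_mem_nhds 0 hR)).2 hf

/-- The slope does not see the constant `k`. On the circle the difference quotient has numerator at
most `2δ` and denominator of modulus `r`; the maximum principle does the rest. The case `k = 1`
serves `γ`, which is close to `1`. -/
theorem norm_dslope_zero_le {f : ℂ → E} {R r δ : ℝ} (k : E) (hr : 0 < r) (hrR : r < R)
    (hf : DifferentiableOn ℂ f (Metric.ball 0 R))
    (hδ : ∀ w ∈ Metric.sphere (0 : ℂ) r, ‖f w - k‖ ≤ δ) :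
    ∀ w ∈ Metric.closedBall (0 : ℂ) r, ‖dslope f 0 w‖ ≤ 2 * δ / r := by
  intro w hw
  refine norm_le_of_norm_le_sphere hr hrR (hf.dslope_zero (hr.trans hrR)) (fun v hv => ?_) hw
  have hv' : ‖v‖ = r := by simpa using hv
  have hv0 : v ≠ 0 := norm_pos_iff.1 (hv' ▸ hr)
  have h0 := norm_le_of_norm_le_sphere hr hrR (hf.sub_const k) hδ (w := 0) (by simpa using hr.le)
  rw [dslope_of_ne _ hv0, slope_def_module, sub_zero, norm_smul, norm_inv, hv', ← div_eq_inv_mul]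
  gcongr
  rw [← sub_sub_sub_cancel_right _ _ k]
  linarith [norm_sub_le (f v - k) (f 0 - k), hδ v hv]

end HolomorphicExtension

/-- The constant integrates to zero, `d z⁻¹` contributes `2πi d`, and the remainder is `O(r⁻²)` on a
circle of length `2πr`, so it disappears in the limit. -/
theorem resInfty_eq {f E : ℂ → ℂ} {R : ℝ} (hR : 0 < R) {c d : ℂ}
    (hE : DifferentiableOn ℂ E (Metric.ball 0 R))
    (hf : ∀ z ∈ puncturedDiscInfty R, f z = c + d * z⁻¹ + z⁻¹ ^ 2 * E z⁻¹) :
    resInfty f = -d := by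
  have hEc : ContinuousAt E 0 := (hE.differentiableAt (Metric.ball_mem_nhds 0 hR)).continuousAt
  obtain ⟨s, hs, hsE⟩ := Metric.eventually_nhds_iff.1
    (hEc.norm.eventually (gt_mem_nhds (lt_add_one ‖E 0‖)))
  set K := ‖E 0‖ + 1
  refine Tendsto.limUnder_eq ?_
  rw [tendsto_iff_norm_sub_tendsto_zero]
  refine squeeze_zero' (g := fun r : ℝ => K * r⁻¹) (Eventually.of_forall fun _ => norm_nonneg _) ?_
    (by simpa using tendsto_inv_atTop_zero.const_mul K)
  filter_upwards [eventually_gt_atTop R⁻¹, eventually_gt_atTop s⁻¹, eventually_gt_atTop 0]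
    with r hr hrs hr0
  have hmem : ∀ z ∈ Metric.sphere (0 : ℂ) r, z ∈ puncturedDiscInfty R ∧ ‖z‖ = r ∧ z ≠ 0 := by
    intro z hz
    have : ‖z‖ = r := by simpa using hz
    exact ⟨by simpa [puncturedDiscInfty, this] using hr, this, norm_pos_iff.1 (this ▸ hr0)⟩
  have hint : CircleIntegrable (fun z : ℂ => z⁻¹ ^ 2 * E z⁻¹) 0 r := by
    refine ContinuousOn.circleIntegrable hr0.le fun z hz => ?_
    obtain ⟨h1, h2, h3⟩ := hmem z hz
    have hz' : z⁻¹ ∈ Metric.ball (0 : ℂ) R := by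
      rw [mem_ball_zero_iff, norm_inv, h2]; exact inv_lt_of_inv_lt₀ hR hr
    have := (hE.differentiableAt (Metric.isOpen_ball.mem_nhds hz')).continuousAt
    exact (((continuousAt_inv₀ h3).pow 2).mul
      (ContinuousAt.comp this (continuousAt_inv₀ h3))).continuousWithinAt
  have hint1 : CircleIntegrable (fun _ : ℂ => c) 0 r := continuousOn_const.circleIntegrable hr0.le
  have hint2 : CircleIntegrable (fun z : ℂ => d * z⁻¹) 0 r :=
    ContinuousOn.circleIntegrable hr0.le
      (continuousOn_const.mul (continuousOn_inv₀.mono fun z hz => (hmem z hz).2.2))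
  have hsplit : ∮ z in C(0, r), f z =
      2 * Real.pi * Complex.I * d + ∮ z in C(0, r), z⁻¹ ^ 2 * E z⁻¹ := by
    rw [circleIntegral.integral_congr hr0.le fun z hz => hf z (hmem z hz).1]
    have h12 : CircleIntegrable (fun z : ℂ => c + d * z⁻¹) 0 r := hint1.add hint2
    rw [circleIntegral.integral_add h12 hint, circleIntegral.integral_add hint1 hint2]
    have h1 : ∮ _ in C(0, r), c = 0 :=
      Complex.circleIntegral_eq_zero_of_differentiable_on_off_countable hr0.le countable_empty
        continuousOn_const fun _ _ => differentiableAt_const _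
    have h2 : ∮ z in C(0, r), d * z⁻¹ = 2 * Real.pi * Complex.I * d := by
      have := circleIntegral.integral_sub_center_inv (0 : ℂ) hr0.ne'
      simp only [sub_zero] at this
      rw [circleIntegral.integral_const_mul, this, mul_comm]
    rw [h1, h2, zero_add]
  have hbound : ‖∮ z in C(0, r), z⁻¹ ^ 2 * E z⁻¹‖ ≤ 2 * Real.pi * r * (r⁻¹ ^ 2 * K) := by
    refine circleIntegral.norm_integral_le_of_norm_le_const hr0.le fun z hz => ?_
    obtain ⟨h1, h2, h3⟩ := hmem z hz
    rw [norm_mul, norm_pow, norm_inv, h2]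
    gcongr
    refine (hsE (y := z⁻¹) ?_).le
    rw [dist_zero_right, norm_inv, h2]
    exact inv_lt_of_inv_lt₀ hs hrs
  have hπ : (2 * Real.pi * Complex.I : ℂ) ≠ 0 := Complex.two_pi_I_ne_zero
  have heq : -(2 * Real.pi * Complex.I : ℂ)⁻¹ * (∮ z in C(0, r), f z) - -d =
      -(2 * Real.pi * Complex.I : ℂ)⁻¹ * ∮ z in C(0, r), z⁻¹ ^ 2 * E z⁻¹ := by
    rw [hsplit]; field_simp; ring
  rw [heq, norm_mul, norm_neg, norm_inv]
  have h2π : ‖(2 * Real.pi * Complex.I : ℂ)‖ = 2 * Real.pi := by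
    simp [abs_of_pos Real.pi_pos]
  rw [h2π]
  calc _ ≤ (2 * Real.pi)⁻¹ * (2 * Real.pi * r * (r⁻¹ ^ 2 * K)) := by gcongr
    _ = K * r⁻¹ := by field_simp

/-! ### Linear differential equations with small coefficients -/

section LinearODE

variable {E : Type*} [NormedAddCommGroup E] [NormedSpace ℂ E] [CompleteSpace E]

/-- A linear holomorphic differential equation on a disc on which its coefficient is small has a
holomorphic solution that is close to its initial value. -/
theorem exists_solution_linearODE_ball {r δ : ℝ} (hr : 0 < r) (hδ : 0 ≤ δ) (hδr : δ * r ≤ 1 / 2)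
    {L : ℂ → E →L[ℂ] E} (hL : DifferentiableOn ℂ L (Metric.ball 0 r))
    (hLδ : ∀ w ∈ Metric.ball (0 : ℂ) r, ‖L w‖ ≤ δ) (x₀ : E) :
    ∃ X : ℂ → E, X 0 = x₀ ∧ (∀ w ∈ Metric.ball (0 : ℂ) r, HasDerivAt X (L w (X w)) w) ∧
      ∀ w ∈ Metric.ball (0 : ℂ) r, ‖X w - x₀‖ ≤ 2 * (δ * r) * ‖x₀‖ := by
  have hprim : ∀ f : ℂ → E, DifferentiableOn ℂ f (Metric.ball 0 r) →
      ∃ g : ℂ → E, g 0 = 0 ∧ ∀ w ∈ Metric.ball (0 : ℂ) r, HasDerivAt g (f w) w :=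
    fun f hf => hf.isExactOn_ball.with_val_at 0 0
  choose! I hI0 hI using hprim
  -- The Picard increments: each is the primitive, vanishing at `0`, of `L` applied to the preceding
  -- one. They decay like `(δ r)^n`, and the solution is their sum.
  let d : ℕ → ℂ → E := fun n => Nat.rec (fun _ => x₀) (fun _ f => I fun w => L w (f w)) n
  have hd1 : ∀ n, d (n + 1) = I fun w => L w (d n w) := fun n => rfl
  have hdiff : ∀ n, DifferentiableOn ℂ (d n) (Metric.ball 0 r) := by
    intro n
    induction n with
    | zero => exact differentiableOn_const x₀
    | succ n ih =>
      intro w hw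
      exact (hI _ (hL.clm_apply ih) w hw).differentiableAt.differentiableWithinAt
  have hder : ∀ n, ∀ w ∈ Metric.ball (0 : ℂ) r, HasDerivAt (d (n + 1)) (L w (d n w)) w :=
    fun n w hw => hI _ (hL.clm_apply (hdiff n)) w hw
  have hq0 : 0 ≤ δ * r := by positivity
  have hbd : ∀ n, ∀ w ∈ Metric.ball (0 : ℂ) r, ‖d n w‖ ≤ (δ * r) ^ n * ‖x₀‖ := by
    intro n
    induction n with
    | zero => intro w _; simp [d]
    | succ n ih =>
      intro w hw
      have h0 : d (n + 1) 0 = 0 := hI0 _ (hL.clm_apply (hdiff n))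
      have := (convex_ball (0 : ℂ) r).norm_image_sub_le_of_norm_hasDerivWithin_le
        (fun v hv => (hder n v hv).hasDerivWithinAt)
        (C := δ * ((δ * r) ^ n * ‖x₀‖)) (fun v hv => ?_) (Metric.mem_ball_self hr) hw
      · rw [h0, sub_zero, sub_zero] at this
        have hw' : ‖w‖ ≤ r := (mem_ball_zero_iff.1 hw).le
        calc _ ≤ _ := this
          _ ≤ δ * ((δ * r) ^ n * ‖x₀‖) * r := by gcongr
          _ = _ := by ring
      · exact (L v).le_of_opNorm_le_of_le (hLδ v hv) (ih v hv)
  have hsum : Summable fun n => (δ * r) ^ n * ‖x₀‖ :=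
    (summable_geometric_of_lt_one hq0 (by linarith)).mul_right _
  have hsumd : ∀ w ∈ Metric.ball (0 : ℂ) r, Summable fun n => d n w :=
    fun w hw => Summable.of_norm_bounded hsum fun n => hbd n w hw
  have hX := Complex.differentiableOn_tsum_of_summable_norm hsum hdiff Metric.isOpen_ball
    fun n w hw => hbd n w hw
  refine ⟨fun w => ∑' n, d n w, ?_, fun w hw => ?_, fun w hw => ?_⟩
  · change ∑' n, d n 0 = x₀
    rw [tsum_eq_single 0]
    · rfl
    · intro n hn
      obtain ⟨m, rfl⟩ := Nat.exists_eq_succ_of_ne_zero hn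
      exact hI0 _ (hL.clm_apply (hdiff m))
  · have h1 := Complex.hasSum_deriv_of_summable_norm hsum hdiff Metric.isOpen_ball
      (fun n w hw => hbd n w hw) hw
    have h2 := (hX.differentiableAt (Metric.isOpen_ball.mem_nhds hw)).hasDerivAt
    have h3 : HasSum (fun n => deriv (d n) w) (L w (∑' n, d n w)) := by
      rw [← hasSum_nat_add_iff' 1]
      have : deriv (d 0) w = 0 := deriv_const w x₀
      simp only [Finset.range_one, Finset.sum_singleton, this, sub_zero]
      simp only [(hder _ w hw).deriv]
      exact (hsumd w hw).hasSum.mapL (L w)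
    rwa [h1.unique h3] at h2
  · have h1 : (∑' n, d n w) - x₀ = ∑' n, d (n + 1) w := by
      rw [(hsumd w hw).tsum_eq_zero_add]; exact add_sub_cancel_left _ _
    change ‖(∑' n, d n w) - x₀‖ ≤ _
    rw [h1]
    have hg : HasSum (fun n : ℕ => (δ * r) ^ n * (δ * r * ‖x₀‖)) ((1 - δ * r)⁻¹ * (δ * r * ‖x₀‖)) :=
      (hasSum_geometric_of_lt_one hq0 (by linarith)).mul_right _
    refine (tsum_of_norm_bounded hg fun n => (hbd (n + 1) w hw).trans_eq (by ring)).trans ?_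
    have : (1 - δ * r)⁻¹ ≤ 2 := by
      rw [inv_le_comm₀ (by linarith) (by norm_num)]; linarith
    calc _ ≤ 2 * (δ * r * ‖x₀‖) := by gcongr
      _ = _ := by ring

end LinearODE

section FundamentalSolution

variable {𝔸 : Type*} [NormedRing 𝔸] [NormedAlgebra ℂ 𝔸] [CompleteSpace 𝔸] [NormOneClass 𝔸]

/-- A fundamental solution of `U' = U η` on a disc, and its inverse. -/
theorem exists_fundamentalSolution_ball {r δ : ℝ} (hr : 0 < r) (hδ : 0 ≤ δ) (hδr : δ * r ≤ 1 / 2)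
    {η : ℂ → 𝔸} (hη : DifferentiableOn ℂ η (Metric.ball 0 r))
    (hηδ : ∀ w ∈ Metric.ball (0 : ℂ) r, ‖η w‖ ≤ δ) :
    ∃ U V : ℂ → 𝔸, (∀ w ∈ Metric.ball (0 : ℂ) r, HasDerivAt V (-(η w * V w)) w) ∧
      (∀ w ∈ Metric.ball (0 : ℂ) r, U w * V w = 1) ∧
      (∀ w ∈ Metric.ball (0 : ℂ) r, ‖U w - 1‖ ≤ 2 * (δ * r)) ∧
      ∀ w ∈ Metric.ball (0 : ℂ) r, ‖V w - 1‖ ≤ 2 * (δ * r) := by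
  obtain ⟨U, hU0, hU, hU1⟩ := exists_solution_linearODE_ball hr hδ hδr
    (L := fun w => (ContinuousLinearMap.mul ℂ 𝔸).flip (η w))
    ((ContinuousLinearMap.mul ℂ 𝔸).flip.differentiable.comp_differentiableOn hη)
    (fun w hw => (ContinuousLinearMap.opNorm_le_bound _ (norm_nonneg _) fun x =>
      (norm_mul_le _ _).trans_eq (mul_comm _ _)).trans (hηδ w hw)) 1
  obtain ⟨V, hV0, hV, hV1⟩ := exists_solution_linearODE_ball hr hδ hδr
    (L := fun w => -ContinuousLinearMap.mul ℂ 𝔸 (η w))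
    ((ContinuousLinearMap.mul ℂ 𝔸).differentiable.comp_differentiableOn hη).neg
    (fun w hw => by
      rw [norm_neg]
      exact (ContinuousLinearMap.opNorm_mul_apply_le ℂ 𝔸 _).trans (hηδ w hw)) 1
  have hUV : ∀ w ∈ Metric.ball (0 : ℂ) r, U w * V w = 1 := by
    intro w hw
    have hd : ∀ v ∈ Metric.ball (0 : ℂ) r, HasDerivWithinAt (fun v => U v * V v) 0
        (Metric.ball 0 r) v := by
      intro v hv
      refine (((hU v hv).mul (hV v hv)).congr_deriv ?_).hasDerivWithinAt
      change U v * η v * V v + U v * -(η v * V v) = 0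
      rw [mul_neg, mul_assoc, add_neg_cancel]
    have := (convex_ball (0 : ℂ) r).norm_image_sub_le_of_norm_hasDerivWithin_le hd
      (C := 0) (fun v _ => by simp) (Metric.mem_ball_self hr) hw
    rw [hU0, hV0, mul_one, zero_mul] at this
    exact sub_eq_zero.1 (norm_le_zero_iff.1 this)
  refine ⟨U, V, fun w hw => ?_, hUV, fun w hw => ?_, fun w hw => ?_⟩
  · exact hV w hw
  · simpa using hU1 w hw
  · simpa using hV1 w hw

omit [CompleteSpace 𝔸] in
/-- Comparison of the solution of `N' = N S`, `N(0) = 1`, with the integral of a coefficient `D`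
close to `S`. -/
theorem norm_sub_one_sub_le_of_hasDerivAt_mul {T κ μ : ℝ} (hT : 0 ≤ T) (hκT : κ * T ≤ 1 / 2)
    {N S P D : ℝ → 𝔸} (hN0 : N 0 = 1)
    (hN : ∀ θ ∈ Icc 0 T, HasDerivAt N (N θ * S θ) θ) (hP : ∀ θ ∈ Icc 0 T, HasDerivAt P (D θ) θ)
    (hS : ∀ θ ∈ Icc 0 T, ‖S θ‖ ≤ κ) (hSD : ∀ θ ∈ Icc 0 T, ‖S θ - D θ‖ ≤ μ) :
    ‖N T - 1 - (P T - P 0)‖ ≤ (2 * κ * T * κ + μ) * T := by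
  have h0 : (0 : ℝ) ∈ Icc 0 T := left_mem_Icc.2 hT
  have hκ : 0 ≤ κ := (norm_nonneg _).trans (hS 0 h0)
  have hcont : ContinuousOn (fun θ => ‖N θ‖) (Icc 0 T) :=
    fun θ hθ => (hN θ hθ).continuousAt.norm.continuousWithinAt
  -- Bootstrap instead of Grönwall: the maximum `m` of `‖N‖` satisfies `m ≤ 1 + m κ T ≤ 1 + m / 2`,
  -- so `m ≤ 2`.
  obtain ⟨θ₁, hθ₁, hmax⟩ := isCompact_Icc.exists_isMaxOn ⟨0, h0⟩ hcont
  have hN1 : ∀ θ ∈ Icc 0 T, ‖N θ - 1‖ ≤ ‖N θ₁‖ * κ * T := by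
    intro θ hθ
    have := (convex_Icc 0 T).norm_image_sub_le_of_norm_hasDerivWithin_le
      (fun v hv => (hN v hv).hasDerivWithinAt) (C := ‖N θ₁‖ * κ) (fun v hv => ?_) h0 hθ
    · rw [hN0, sub_zero, Real.norm_of_nonneg hθ.1] at this
      exact this.trans (mul_le_mul_of_nonneg_left hθ.2 (by positivity))
    · exact (norm_mul_le _ _).trans (mul_le_mul (hmax hv) (hS v hv) (norm_nonneg _) (norm_nonneg _))
  have hle2 : ‖N θ₁‖ ≤ 2 := by
    have h1 := hN1 θ₁ hθ₁
    have h2 : ‖N θ₁‖ ≤ ‖N θ₁ - 1‖ + 1 := by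
      simpa using norm_add_le (N θ₁ - 1) 1
    nlinarith [norm_nonneg (N θ₁)]
  have := (convex_Icc 0 T).norm_image_sub_le_of_norm_hasDerivWithin_le
    (f := fun θ => N θ - P θ) (fun v hv => ((hN v hv).sub (hP v hv)).hasDerivWithinAt)
    (C := 2 * κ * T * κ + μ) (fun v hv => ?_) h0 (right_mem_Icc.2 hT)
  · rw [sub_zero, Real.norm_of_nonneg hT, hN0] at this
    rw [show N T - 1 - (P T - P 0) = N T - P T - (1 - P 0) by abel]
    exact this
  · have h1 : N v * S v - D v = (N v - 1) * S v + (S v - D v) := by noncomm_ring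
    rw [h1]
    refine (norm_add_le _ _).trans (add_le_add ((norm_mul_le _ _).trans ?_) (hSD v hv))
    have h2 : ‖N v - 1‖ ≤ 2 * κ * T := (hN1 v hv).trans (by gcongr)
    exact mul_le_mul h2 (hS v hv) (norm_nonneg _) (by positivity)

omit [CompleteSpace 𝔸] in
/-- The comparison along a vertical segment, for functions of a complex variable. -/
theorem norm_sub_one_sub_le_of_hasDerivAt_mul_vertical {T κ μ : ℝ} (hT : 0 ≤ T)
    (hκT : κ * T ≤ 1 / 2) {N S P D : ℂ → 𝔸} {ζ₀ : ℂ} (hN0 : N ζ₀ = 1)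
    (hN : ∀ ζ : ℂ, ζ.re = ζ₀.re → HasDerivAt N (N ζ * S ζ) ζ)
    (hP : ∀ ζ : ℂ, ζ.re = ζ₀.re → HasDerivAt P (D ζ) ζ)
    (hS : ∀ ζ : ℂ, ζ.re = ζ₀.re → ‖S ζ‖ ≤ κ) (hSD : ∀ ζ : ℂ, ζ.re = ζ₀.re → ‖S ζ - D ζ‖ ≤ μ) :
    ‖N (ζ₀ + T * Complex.I) - 1 - (P (ζ₀ + T * Complex.I) - P ζ₀)‖ ≤
      (2 * κ * T * κ + μ) * T := by
  let h : ℝ → ℂ := fun θ => ζ₀ + θ * Complex.I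
  have hre : ∀ θ, (h θ).re = ζ₀.re := fun θ => by simp [h]
  have hh : ∀ θ, HasDerivAt h Complex.I θ := fun θ => by
    simpa [h] using ((Complex.ofRealCLM.hasDerivAt (x := θ)).mul_const Complex.I).const_add ζ₀
  have h0 : h 0 = ζ₀ := by simp [h]
  have key := norm_sub_one_sub_le_of_hasDerivAt_mul hT hκT (N := fun θ => N (h θ))
    (S := fun θ => Complex.I • S (h θ)) (P := fun θ => P (h θ)) (D := fun θ => Complex.I • D (h θ))
    (μ := μ) (by simpa only [h0] using hN0)
    (fun θ _ => by
      rw [mul_smul_comm]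
      exact (hN (h θ) (hre θ)).scomp θ (hh θ))
    (fun θ _ => (hP (h θ) (hre θ)).scomp θ (hh θ))
    (fun θ _ => by rw [norm_smul, Complex.norm_I, one_mul]; exact hS _ (hre θ))
    (fun θ _ => by rw [← smul_sub, norm_smul, Complex.norm_I, one_mul]; exact hSD _ (hre θ))
  simpa only [h0] using key

end FundamentalSolution

-- Trace-free parts and coercivity on `SU(2)`

attribute [local instance] Matrix.linftyOpNormedRing Matrix.linftyOpNormedAlgebra

section MatrixTwo

theorem norm_matrix_two (M : Matrix (Fin 2) (Fin 2) ℂ) :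
    ‖M‖ = max (‖M 0 0‖ + ‖M 0 1‖) (‖M 1 0‖ + ‖M 1 1‖) := by
  rw [Matrix.linfty_opNorm_def]
  have : (Finset.univ : Finset (Fin 2)) = {0, 1} := by decide
  simp [this]

theorem norm_matrix_two_apply_le (M : Matrix (Fin 2) (Fin 2) ℂ) (i j : Fin 2) : ‖M i j‖ ≤ ‖M‖ := by
  rw [norm_matrix_two]
  have h0 := norm_nonneg (M 0 0)
  have h1 := norm_nonneg (M 0 1)
  have h2 := norm_nonneg (M 1 0)
  have h3 := norm_nonneg (M 1 1)
  fin_cases i <;> fin_cases j <;> simp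

theorem norm_matrix_two_le {M : Matrix (Fin 2) (Fin 2) ℂ} {c : ℝ} (h : ∀ i j, ‖M i j‖ ≤ c) :
    ‖M‖ ≤ 2 * c := by
  rw [norm_matrix_two]
  exact max_le (by linarith [h 0 0, h 0 1]) (by linarith [h 1 0, h 1 1])

theorem hasDerivAt_matrix_two {M : ℂ → Matrix (Fin 2) (Fin 2) ℂ}
    {M' : Matrix (Fin 2) (Fin 2) ℂ} {x : ℂ}
    (h : ∀ i j, HasDerivAt (fun x => M x i j) (M' i j) x) : HasDerivAt M M' x := by
  have h1 : ∀ A : Matrix (Fin 2) (Fin 2) ℂ,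
      A = ∑ i, ∑ j, A i j • Matrix.single i j (1 : ℂ) := by
    intro A
    conv_lhs => rw [Matrix.matrix_eq_sum_single A]
    simp
  have h2 := HasDerivAt.fun_sum (u := Finset.univ) fun i (_ : i ∈ Finset.univ) =>
    HasDerivAt.fun_sum (u := Finset.univ) fun j (_ : j ∈ Finset.univ) =>
      (h i j).smul_const (Matrix.single i j (1 : ℂ))
  rw [← h1 M'] at h2
  exact h2.congr_of_eventuallyEq (Eventually.of_forall fun x => h1 (M x))

/-- The trace-free part of a `2 × 2` matrix. -/
def traceFree (M : Matrix (Fin 2) (Fin 2) ℂ) : Matrix (Fin 2) (Fin 2) ℂ :=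
  M - (M.trace / 2) • 1

theorem traceFree_eq (M : Matrix (Fin 2) (Fin 2) ℂ) :
    traceFree M = !![(M 0 0 - M 1 1) / 2, M 0 1; M 1 0, -((M 0 0 - M 1 1) / 2)] := by
  ext i j
  fin_cases i <;> fin_cases j <;> simp [traceFree, Matrix.trace_fin_two] <;> ring

theorem traceFree_conj {V W N : Matrix (Fin 2) (Fin 2) ℂ} (hVW : V * W = 1) :
    traceFree (V * N * W) = V * traceFree N * W := by
  have : (V * N * W).trace = N.trace := by
    rw [Matrix.trace_mul_comm, ← mul_assoc, mul_eq_one_comm.1 hVW, one_mul]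
  rw [traceFree, traceFree, this, mul_sub, sub_mul]
  simp [hVW]

/-- Such an `M` is `(p, s; -s̄, p̄)`, with trace-free part `(i Im p, s; -s̄, -i Im p)` in `su(2)`.
Its norm is `|Im p| + |s|` and its determinant is `(Im p)² + |s|²`. -/
theorem det_traceFree_of_mem_specialUnitaryGroup {M : Matrix (Fin 2) (Fin 2) ℂ}
    (hM : M ∈ Matrix.specialUnitaryGroup (Fin 2) ℂ) :
    ‖traceFree M‖ ^ 2 ≤ 2 * (traceFree M).det.re := by
  obtain ⟨hU, hdet⟩ := Matrix.mem_specialUnitaryGroup_iff.1 hM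
  have hadj : star M = M.adjugate := by
    have h1 : star M * M = 1 := (Matrix.mem_unitaryGroup_iff').1 hU
    have h2 : M * M.adjugate = 1 := by rw [Matrix.mul_adjugate, hdet, one_smul]
    calc star M = star M * (M * M.adjugate) := by rw [h2, mul_one]
      _ = _ := by rw [← mul_assoc, h1, one_mul]
  rw [Matrix.adjugate_fin_two] at hadj
  have h11 : star (M 0 0) = M 1 1 := by simpa using congrFun (congrFun hadj 0) 0
  have h10 : star (M 0 1) = -M 1 0 := by simpa using congrFun (congrFun hadj 1) 0
  have e1 : M 1 1 = (starRingEnd ℂ) (M 0 0) := h11.symm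
  have e2 : M 1 0 = -(starRingEnd ℂ) (M 0 1) := by
    rw [← neg_eq_iff_eq_neg]; exact h10.symm
  rw [traceFree_eq, norm_matrix_two, Matrix.det_fin_two, e1, e2]
  have e3 : (M 0 0 - (starRingEnd ℂ) (M 0 0)) / 2 = ((M 0 0).im : ℂ) * Complex.I := by
    rw [Complex.sub_conj]; push_cast; ring
  simp only [e3, Matrix.of_apply, Matrix.cons_val', Matrix.cons_val_zero, Matrix.cons_val_one,
    Matrix.cons_val_fin_one, norm_neg, RCLike.norm_conj]
  rw [add_comm ‖M 0 1‖, max_self]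
  have e4 : ((M 0 0).im * Complex.I * -((M 0 0).im * Complex.I) -
      M 0 1 * -(starRingEnd ℂ) (M 0 1)).re = (M 0 0).im ^ 2 + ‖M 0 1‖ ^ 2 := by
    rw [← Complex.normSq_eq_norm_sq]
    simp [Complex.normSq_apply]
    ring
  rw [e4, norm_mul, Complex.norm_I, mul_one, Complex.norm_real, Real.norm_eq_abs]
  nlinarith [sq_abs (M 0 0).im, sq_nonneg (|(M 0 0).im| - ‖M 0 1‖)]

theorem norm_traceFree_le (M : Matrix (Fin 2) (Fin 2) ℂ) : ‖traceFree M‖ ≤ 2 * ‖M‖ := by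
  have h1 : ‖M.trace / 2‖ ≤ ‖M‖ := by
    rw [norm_div, Matrix.trace_fin_two]
    have := norm_add_le (M 0 0) (M 1 1)
    have := norm_matrix_two_apply_le M 0 0
    have := norm_matrix_two_apply_le M 1 1
    simp only [Complex.norm_ofNat]
    linarith
  have h2 : ‖(M.trace / 2) • (1 : Matrix (Fin 2) (Fin 2) ℂ)‖ ≤ ‖M‖ := by
    rw [norm_smul, Matrix.linfty_opNormOneClass.norm_one, mul_one]
    exact h1
  exact (norm_sub_le _ _).trans (by linarith)

theorem norm_mul_sub_mul_le {a b a' b' : ℂ} {s e : ℝ} (ha : ‖a‖ ≤ s) (hb : ‖b‖ ≤ s)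
    (ha' : ‖a' - a‖ ≤ e) (hb' : ‖b' - b‖ ≤ e) : ‖a' * b' - a * b‖ ≤ 2 * s * e + e * e := by
  have h : a' * b' - a * b = a * (b' - b) + b * (a' - a) + (a' - a) * (b' - b) := by ring
  have hs : 0 ≤ s := (norm_nonneg _).trans ha
  have he : 0 ≤ e := (norm_nonneg _).trans ha'
  rw [h]
  refine (norm_add₃_le).trans ?_
  rw [norm_mul, norm_mul, norm_mul]
  have h1 : ‖a‖ * ‖b' - b‖ ≤ s * e := by gcongr
  have h2 : ‖b‖ * ‖a' - a‖ ≤ s * e := by gcongr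
  have h3 : ‖a' - a‖ * ‖b' - b‖ ≤ e * e := by gcongr
  linarith

/-- The first-order part of the monodromy. -/
def residueMatrix (X Y Z : ℂ) : Matrix (Fin 2) (Fin 2) ℂ :=
  (2 * Real.pi * Complex.I) • !![Y, Z; -X, -Y]

theorem norm_residueMatrix (X Y Z : ℂ) :
    ‖residueMatrix X Y Z‖ = 2 * Real.pi * max (‖Y‖ + ‖Z‖) (‖X‖ + ‖Y‖) := by
  have : ‖(2 * Real.pi * Complex.I : ℂ)‖ = 2 * Real.pi := by
    simp [abs_of_pos Real.pi_pos]
  rw [residueMatrix, norm_smul, this, norm_matrix_two]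
  simp

theorem det_residueMatrix (X Y Z : ℂ) :
    (residueMatrix X Y Z).det = ((4 * Real.pi ^ 2 : ℝ) : ℂ) * (Y ^ 2 - X * Z) := by
  rw [residueMatrix, Matrix.det_smul, Matrix.det_fin_two]
  simp only [Fintype.card_fin, Matrix.of_apply, Matrix.cons_val', Matrix.cons_val_zero,
    Matrix.cons_val_one, Matrix.cons_val_fin_one, mul_pow, Complex.I_sq]
  push_cast
  ring

/-- The determinant of the trace-free part is invariant under conjugation, so the lower bound valid
for `M` in `SU(2)` passes to `N` at the cost of powers of `κ`. Replacing the trace-free part of `N`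
by the residue matrix turns the determinant into `4π² (Y² - XZ)`, with an error quadratic in `q`
that is absorbed on the left. -/
theorem coercive_of_conj_mem_specialUnitaryGroup {κ : ℝ} (hκ : 1 ≤ κ)
    {V W M N : Matrix (Fin 2) (Fin 2) ℂ} (hVW : V * W = 1) (hV : ‖V‖ ≤ κ) (hW : ‖W‖ ≤ κ)
    (hMN : M = V * N * W) (hM : M ∈ Matrix.specialUnitaryGroup (Fin 2) ℂ) {X Y Z : ℂ}
    (hN : ‖N - 1 - residueMatrix X Y Z‖ ≤ (60 * κ ^ 4)⁻¹ * (‖X‖ + ‖Y‖ + ‖Z‖)) :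
    (‖X‖ + ‖Y‖ + ‖Z‖) ^ 2 ≤ 4 * Real.pi ^ 2 * κ ^ 4 * (Y ^ 2 - X * Z).re ∧
      ‖X‖ + ‖Y‖ + ‖Z‖ ≤ κ ^ 2 * ‖traceFree M‖ := by
  set q := ‖X‖ + ‖Y‖ + ‖Z‖
  have hq : 0 ≤ q := by positivity
  set A := residueMatrix X Y Z with hA
  have hκ4 : 1 ≤ κ ^ 4 := one_le_pow₀ hκ
  -- Twice the constant of the hypothesis, since taking trace-free parts may double the norm. In the
  -- last step the error contributes `60 e κ⁴ q² = 2 q²`, half of the `4 q²` on the left.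
  set e := (30 * κ ^ 4)⁻¹ with he
  have he0 : 0 < e := by positivity
  have heκ : e * κ ^ 4 = 1 / 30 := by rw [he]; field_simp
  have he1 : e ≤ 1 / 30 := by nlinarith
  have hWV : W * V = 1 := mul_eq_one_comm.1 hVW
  have hE : ‖traceFree N - A‖ ≤ e * q := by
    have h1 : traceFree N - A = traceFree (N - 1 - A) := by
      rw [hA, residueMatrix]
      ext i j
      fin_cases i <;> fin_cases j <;> simp [traceFree_eq] <;> ring
    rw [h1]
    refine (norm_traceFree_le _).trans ?_
    refine (mul_le_mul_of_nonneg_left hN zero_le_two).trans_eq ?_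
    rw [he, mul_inv, mul_inv]; ring
  have hAn := norm_residueMatrix X Y Z
  rw [← hA] at hAn
  have hAu : ‖A‖ ≤ 7 * q := by
    rw [hAn]
    have : max (‖Y‖ + ‖Z‖) (‖X‖ + ‖Y‖) ≤ q :=
      max_le (by linarith [norm_nonneg X]) (by linarith [norm_nonneg Z])
    have := Real.pi_lt_d2
    nlinarith [Real.pi_pos]
  have hAl : 3 * q ≤ ‖A‖ := by
    rw [hAn]
    have h1 := le_max_left (‖Y‖ + ‖Z‖) (‖X‖ + ‖Y‖)
    have h2 := le_max_right (‖Y‖ + ‖Z‖) (‖X‖ + ‖Y‖)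
    have h3 : q ≤ 2 * max (‖Y‖ + ‖Z‖) (‖X‖ + ‖Y‖) := by linarith [norm_nonneg Y]
    nlinarith [Real.pi_gt_three]
  have hNl : 2 * q ≤ ‖traceFree N‖ := by
    have := norm_sub_norm_le A (traceFree N)
    rw [norm_sub_rev] at this
    nlinarith
  have hNM : traceFree N = W * traceFree M * V := by
    rw [hMN, traceFree_conj hVW]
    calc traceFree N = (W * V) * traceFree N * (W * V) := by rw [hWV, one_mul, mul_one]
      _ = _ := by simp only [mul_assoc]
  have hκM : ‖traceFree N‖ ≤ κ ^ 2 * ‖traceFree M‖ := by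
    rw [hNM]
    calc _ ≤ ‖W‖ * ‖traceFree M‖ * ‖V‖ :=
          (norm_mul_le _ _).trans (by gcongr; exact norm_mul_le _ _)
      _ ≤ κ * ‖traceFree M‖ * κ := by gcongr
      _ = _ := by ring
  refine ⟨?_, by linarith⟩
  have hdet : (traceFree M).det = (traceFree N).det := by
    rw [hNM, Matrix.det_mul, Matrix.det_mul, mul_right_comm, ← Matrix.det_mul, hWV,
      Matrix.det_one, one_mul]
  have h1 := det_traceFree_of_mem_specialUnitaryGroup hM
  rw [hdet] at h1
  -- Each of the two products of entries changes by at most `2 · 7q · eq + (eq)² ≤ 15 e q²`.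
  have hdetle : ‖(traceFree N).det - A.det‖ ≤ 30 * e * q ^ 2 := by
    have hent : ∀ i j, ‖traceFree N i j - A i j‖ ≤ e * q := fun i j =>
      (norm_matrix_two_apply_le (traceFree N - A) i j).trans hE
    have hAent : ∀ i j, ‖A i j‖ ≤ 7 * q := fun i j => (norm_matrix_two_apply_le A i j).trans hAu
    rw [Matrix.det_fin_two, Matrix.det_fin_two, sub_sub_sub_comm]
    refine (norm_sub_le _ _).trans ?_
    have h2 := norm_mul_sub_mul_le (hAent 0 0) (hAent 1 1) (hent 0 0) (hent 1 1)
    have h3 := norm_mul_sub_mul_le (hAent 0 1) (hAent 1 0) (hent 0 1) (hent 1 0)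
    have h4 : e * q * (e * q) ≤ e * q ^ 2 := by
      have : e * (e * q ^ 2) ≤ 1 * (e * q ^ 2) := by gcongr; linarith
      linarith
    nlinarith
  have hre : (traceFree N).det.re ≤ 4 * Real.pi ^ 2 * (Y ^ 2 - X * Z).re + 30 * e * q ^ 2 := by
    have h2 := (Complex.re_le_norm _).trans hdetle
    rw [Complex.sub_re, hA, det_residueMatrix, Complex.re_ofReal_mul] at h2
    linarith
  have h2 : (2 * q) ^ 2 ≤ κ ^ 4 * ‖traceFree M‖ ^ 2 := by
    calc (2 * q) ^ 2 ≤ (κ ^ 2 * ‖traceFree M‖) ^ 2 :=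
          pow_le_pow_left₀ (by positivity) (hNl.trans hκM) 2
      _ = _ := by ring
  have h3 : κ ^ 4 * ‖traceFree M‖ ^ 2 ≤
      κ ^ 4 * (2 * (4 * Real.pi ^ 2 * (Y ^ 2 - X * Z).re + 30 * e * q ^ 2)) := by
    gcongr
    linarith
  have h4 : κ ^ 4 * (2 * (30 * e * q ^ 2)) = 2 * q ^ 2 := by
    calc _ = 60 * (e * κ ^ 4) * q ^ 2 := by ring
      _ = _ := by rw [heκ]; ring
  nlinarith

end MatrixTwo

/-! ### Regular and polar parts of the gauged potential -/

/-- The expansion at `w = 1/z = 0` of a potential `(α, λ⁻¹β; γ, -α) dz`, for a fixed `λ`: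
`α = w (a₀ + a₁ w + a(w) w²)`, `β = w (b₀ + b₁ w + b₂ w² + b(w) w³)` and
`γ = c₀ + c₁ w + c(w) w²`. -/
structure PotentialExpansion where
  (a₀ a₁ b₀ b₁ b₂ c₀ c₁ : ℂ)
  (a b c : ℂ → ℂ)

namespace PotentialExpansion

variable (J : PotentialExpansion) (l w : ℂ)

def alpha : ℂ := w * (J.a₀ + w * (J.a₁ + w * J.a w))

def beta : ℂ := w * (J.b₀ + w * (J.b₁ + w * (J.b₂ + w * J.b w)))

def gamma : ℂ := J.c₀ + w * (J.c₁ + w * J.c w)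

/-- The coefficient of the potential with respect to `dz`, at `z = 1/w`. -/
def potential : Matrix (Fin 2) (Fin 2) ℂ :=
  !![J.alpha w, l⁻¹ * J.beta w; J.gamma w, -J.alpha w]

/-- The coefficient of the gauge that removes the singularity of the diagonal terms. -/
def gaugeCoeff : ℂ := (J.a₀ - 1) / J.c₀

/-- The coefficient of `w⁻³` in the gauged potential, up to sign. -/
def polar₃ : ℂ := l⁻¹ * J.b₀

/-- The coefficient of `w⁻²` in the gauged potential, up to sign. -/
def polar₂ : ℂ := l⁻¹ * J.b₁ + J.gaugeCoeff * J.a₀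

/-- The coefficient of `w⁻¹` in the gauged potential, up to sign. -/
def polar₁ : ℂ := l⁻¹ * J.b₂ + 2 * J.gaugeCoeff * J.a₁ - J.gaugeCoeff ^ 2 * J.c₁

/-- The size of the polar part of the gauged potential. -/
def polarNorm : ℝ := ‖J.polar₃ l‖ + ‖J.polar₂ l‖ + ‖J.polar₁ l‖

/-- The diagonal coefficient of the gauged potential with respect to `dw`. -/
def regDiag : ℂ := -(J.a₁ + w * J.a w - J.gaugeCoeff * (J.c₁ + w * J.c w))

/-- The upper right coefficient of the regular part of the gauged potential, up to sign. -/
def regUpper : ℂ := l⁻¹ * J.b w + 2 * J.gaugeCoeff * J.a w - J.gaugeCoeff ^ 2 * J.c w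

/-- The regular part of the potential in the frame in which the unperturbed potential vanishes. -/
def regPart : Matrix (Fin 2) (Fin 2) ℂ :=
  !![J.regDiag w - w * J.regUpper l w, -J.regUpper l w;
    1 - J.gamma w - 2 * w * J.regDiag w + w ^ 2 * J.regUpper l w,
    w * J.regUpper l w - J.regDiag w]

/-- The polar part of the potential, with respect to `dζ` where `w = exp (-ζ)`, in the frame in
which the unperturbed potential vanishes. -/
def polarPart : Matrix (Fin 2) (Fin 2) ℂ :=
  !![J.polar₃ l * w⁻¹ + J.polar₂ l + J.polar₁ l * w,
    J.polar₃ l * w⁻¹ ^ 2 + J.polar₂ l * w⁻¹ + J.polar₁ l;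
    -(J.polar₃ l + J.polar₂ l * w + J.polar₁ l * w ^ 2),
    -(J.polar₃ l * w⁻¹ + J.polar₂ l + J.polar₁ l * w)]

/-- The change of frame in which the unperturbed potential vanishes. -/
def frame : Matrix (Fin 2) (Fin 2) ℂ := !![(1 + J.gaugeCoeff) * w, J.gaugeCoeff; 1, w⁻¹]

/-- The derivative of `frame` along `ζ`, where `w = exp (-ζ)`. -/
def frameDeriv : Matrix (Fin 2) (Fin 2) ℂ := !![-(1 + J.gaugeCoeff) * w, 0; 0, w⁻¹]

variable {J l w}

/-- The gauge equation along `ζ = log z`, where `dz = w⁻¹ dζ` and `dw = -w dζ`. The frame is `(w, g;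
0, w⁻¹)` times `(1, 0; w, 1)`; the second factor kills the unperturbed lower left entry and
conjugates the nilpotent polar term into a multiple of `(w, 1; -w², -w)`. The relation `a₀ = g c₀ +
1` makes the diagonal poles cancel. -/
theorem potential_mul_frame (hc : J.c₀ ≠ 0) (hw : w ≠ 0) :
    w⁻¹ • (J.potential l w * J.frame w) + J.frameDeriv w =
      J.frame w * (-w • J.regPart l w + J.polarPart l w) := by
  have hg : J.gaugeCoeff * J.c₀ = J.a₀ - 1 := div_mul_cancel₀ _ hc
  have ha : J.a₀ = J.gaugeCoeff * J.c₀ + 1 := by rw [hg]; ring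
  ext i j
  fin_cases i <;> fin_cases j <;>
    simp [potential, frame, frameDeriv, regPart, polarPart, Matrix.mul_apply, Fin.sum_univ_two,
      alpha, beta, gamma, regDiag, regUpper, polar₁, polar₂, polar₃] <;>
    rw [ha] <;> generalize J.gaugeCoeff = g <;> field_simp <;> ring

theorem det_frame (hw : w ≠ 0) : (J.frame w).det = 1 := by
  rw [frame, Matrix.det_fin_two_of, mul_assoc, mul_inv_cancel₀ hw]; ring

/-- The expansion is `δ`-close to the one of the unperturbed potential `(0, 0; 1, 0) dz`, on the
disc of radius `r`. -/
structure IsClose (J : PotentialExpansion) (r δ : ℝ) : Prop where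
  a₀ : ‖J.a₀‖ ≤ δ
  a₁ : ‖J.a₁‖ ≤ δ
  b₀ : ‖J.b₀‖ ≤ δ
  b₁ : ‖J.b₁‖ ≤ δ
  b₂ : ‖J.b₂‖ ≤ δ
  c₀ : ‖J.c₀ - 1‖ ≤ δ
  c₁ : ‖J.c₁‖ ≤ δ
  a : ∀ w ∈ Metric.ball (0 : ℂ) r, ‖J.a w‖ ≤ δ
  b : ∀ w ∈ Metric.ball (0 : ℂ) r, ‖J.b w‖ ≤ δ
  c : ∀ w ∈ Metric.ball (0 : ℂ) r, ‖J.c w‖ ≤ δ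
  differentiableOn_a : DifferentiableOn ℂ J.a (Metric.ball 0 r)
  differentiableOn_b : DifferentiableOn ℂ J.b (Metric.ball 0 r)
  differentiableOn_c : DifferentiableOn ℂ J.c (Metric.ball 0 r)

namespace IsClose

variable {r δ : ℝ} (h : J.IsClose r δ) (hδ : δ ≤ 1 / 2)

include h

theorem nonneg : 0 ≤ δ := (norm_nonneg _).trans h.a₀

include hδ

theorem one_half_le_norm_c₀ : 1 / 2 ≤ ‖J.c₀‖ := by
  have := norm_sub_norm_le (1 : ℂ) J.c₀
  rw [norm_one, norm_sub_rev] at this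
  linarith [h.c₀]

theorem c₀_ne_zero : J.c₀ ≠ 0 := by
  rw [← norm_pos_iff]
  linarith [h.one_half_le_norm_c₀ hδ]

/-- For the unperturbed potential `a₀ = 0` and `c₀ = 1`, so the gauge coefficient is `-1`. -/
theorem norm_one_add_gaugeCoeff_le : ‖1 + J.gaugeCoeff‖ ≤ 4 * δ := by
  have h1 := h.one_half_le_norm_c₀ hδ
  have h2 : 1 + J.gaugeCoeff = (J.a₀ + (J.c₀ - 1)) / J.c₀ := by
    rw [gaugeCoeff]; field_simp [h.c₀_ne_zero hδ]; ring
  have h3 := norm_add_le_of_le h.a₀ h.c₀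
  rw [h2, norm_div, div_le_iff₀ (by linarith)]
  nlinarith [h.nonneg]

theorem norm_gaugeCoeff_le : ‖J.gaugeCoeff‖ ≤ 3 := by
  have h1 := h.norm_one_add_gaugeCoeff_le hδ
  have h2 : J.gaugeCoeff = (1 + J.gaugeCoeff) - 1 := by ring
  rw [h2]
  refine (norm_sub_le _ _).trans ?_
  rw [norm_one]; linarith

/-- `polar₁` and `regUpper` both have this shape. The constant is `1 + 2 · 3 + 3²`, from `|g| ≤ 3`.
-/
theorem norm_combination_le (hl : ‖l‖ = 1) {x y z : ℂ} (hx : ‖x‖ ≤ δ) (hy : ‖y‖ ≤ δ)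
    (hz : ‖z‖ ≤ δ) :
    ‖l⁻¹ * x + 2 * J.gaugeCoeff * y - J.gaugeCoeff ^ 2 * z‖ ≤ 16 * δ := by
  have hg := h.norm_gaugeCoeff_le hδ
  have hδ0 := h.nonneg
  refine (norm_sub_le _ _).trans ((add_le_add_left (norm_add_le _ _) _).trans ?_)
  rw [norm_mul, norm_mul, norm_mul, norm_mul, norm_inv, hl, norm_pow, inv_one, one_mul,
    Complex.norm_ofNat]
  have h1 : ‖J.gaugeCoeff‖ * ‖y‖ ≤ 3 * δ := by gcongr
  have h2 : ‖J.gaugeCoeff‖ ^ 2 * ‖z‖ ≤ 3 ^ 2 * δ := by gcongr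
  linarith

theorem polarNorm_le (hl : ‖l‖ = 1) : J.polarNorm l ≤ 21 * δ := by
  have h1 := h.norm_combination_le hδ hl h.b₂ h.a₁ h.c₁
  have hg := h.norm_gaugeCoeff_le hδ
  have hδ0 := h.nonneg
  have h2 : ‖J.polar₃ l‖ ≤ δ := by
    rw [polar₃, norm_mul, norm_inv, hl, inv_one, one_mul]; exact h.b₀
  have h3 : ‖J.polar₂ l‖ ≤ δ + 3 * δ := by
    refine norm_add_le_of_le ?_ ?_
    · rw [norm_mul, norm_inv, hl, inv_one, one_mul]; exact h.b₁
    · rw [norm_mul]; exact mul_le_mul hg h.a₀ (norm_nonneg _) (by norm_num)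
  rw [polarNorm, polar₁]
  linarith

/-- The entries are built from `regDiag`, `regUpper` and `1 - γ`, which all vanish for the
unperturbed potential. -/
theorem norm_regPart_le (hl : ‖l‖ = 1) (hw : w ∈ Metric.ball (0 : ℂ) r) :
    ‖J.regPart l w‖ ≤ 50 * (1 + r) ^ 2 * δ := by
  have hδ0 := h.nonneg
  have hwr : ‖w‖ ≤ r := (mem_ball_zero_iff.1 hw).le
  have hr : 0 ≤ r := (norm_nonneg w).trans hwr
  have hg := h.norm_gaugeCoeff_le hδ
  have hmul : ∀ {x : ℂ} {k : ℝ}, ‖x‖ ≤ k → ‖w * x‖ ≤ r * k := fun hx => by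
    rw [norm_mul]; exact mul_le_mul hwr hx (norm_nonneg _) hr
  have hQ : ‖J.regUpper l w‖ ≤ 16 * δ := h.norm_combination_le hδ hl (h.b w hw) (h.a w hw) (h.c w hw)
  have hwQ := hmul hQ
  have hwwQ := hmul hwQ
  have hp : ‖J.regDiag w‖ ≤ (δ + r * δ) + 3 * (δ + r * δ) := by
    rw [regDiag, norm_neg]
    refine norm_sub_le_of_le (norm_add_le_of_le h.a₁ (hmul (h.a w hw))) ?_
    rw [norm_mul]
    exact mul_le_mul hg (norm_add_le_of_le h.c₁ (hmul (h.c w hw))) (norm_nonneg _) (by norm_num)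
  have hwp := hmul hp
  have hk : ‖1 - J.gamma w‖ ≤ δ + r * (δ + r * δ) := by
    rw [gamma, ← norm_neg, show -(1 - (J.c₀ + w * (J.c₁ + w * J.c w))) =
      (J.c₀ - 1) + w * (J.c₁ + w * J.c w) by ring]
    exact norm_add_le_of_le h.c₀ (hmul (norm_add_le_of_le h.c₁ (hmul (h.c w hw))))
  have hrδ : 0 ≤ r * δ := by positivity
  have hrrδ : 0 ≤ r ^ 2 * δ := by positivity
  rw [show 50 * (1 + r) ^ 2 * δ = 2 * (25 * (1 + r) ^ 2 * δ) by ring]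
  refine norm_matrix_two_le fun i j => ?_
  fin_cases i <;> fin_cases j
  · change ‖J.regDiag w - w * J.regUpper l w‖ ≤ _
    refine (norm_sub_le_of_le hp hwQ).trans ?_
    nlinarith
  · change ‖-J.regUpper l w‖ ≤ _
    rw [norm_neg]
    nlinarith
  · change ‖1 - J.gamma w - 2 * w * J.regDiag w + w ^ 2 * J.regUpper l w‖ ≤ _
    rw [show 1 - J.gamma w - 2 * w * J.regDiag w + w ^ 2 * J.regUpper l w =
      (1 - J.gamma w) - (w * J.regDiag w + w * J.regDiag w) + w * (w * J.regUpper l w) by ring]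
    refine (norm_add_le_of_le (norm_sub_le_of_le hk (norm_add_le_of_le hwp hwp)) hwwQ).trans ?_
    nlinarith
  · change ‖w * J.regUpper l w - J.regDiag w‖ ≤ _
    refine (norm_sub_le_of_le hwQ hp).trans ?_
    nlinarith

omit hδ in
theorem differentiableOn_regPart : DifferentiableOn ℂ (J.regPart l) (Metric.ball 0 r) := by
  intro w hw
  have ha := (h.differentiableOn_a.differentiableAt (Metric.isOpen_ball.mem_nhds hw))
  have hb := (h.differentiableOn_b.differentiableAt (Metric.isOpen_ball.mem_nhds hw))
  have hc := (h.differentiableOn_c.differentiableAt (Metric.isOpen_ball.mem_nhds hw))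
  have hp : DifferentiableAt ℂ J.regDiag w := by unfold regDiag; fun_prop
  have hq : DifferentiableAt ℂ (J.regUpper l) w := by unfold regUpper; fun_prop
  have hk : DifferentiableAt ℂ J.gamma w := by unfold gamma; fun_prop
  refine (hasDerivAt_matrix_two (M' := Matrix.of fun i j => deriv (fun w => J.regPart l w i j) w)
    fun i j => ?_).differentiableAt.differentiableWithinAt
  refine DifferentiableAt.hasDerivAt ?_
  fin_cases i <;> fin_cases j <;> simp [regPart] <;> fun_prop

theorem norm_frame_le {i j : Fin 2} : ‖J.frame w i j‖ ≤ 3 + 2 * ‖w‖ + ‖w‖⁻¹ := by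
  have hg := h.norm_gaugeCoeff_le hδ
  have hg1 := h.norm_one_add_gaugeCoeff_le hδ
  have h1 : ‖(1 + J.gaugeCoeff) * w‖ ≤ 2 * ‖w‖ := by
    rw [norm_mul]; gcongr; linarith
  have h2 : 0 ≤ ‖w‖⁻¹ := by positivity
  have h3 := norm_nonneg w
  fin_cases i <;> fin_cases j <;> simp [frame] <;> first | linarith | (rw [norm_mul] at h1; linarith)

end IsClose

theorem norm_polarPart_le (J : PotentialExpansion) (l w : ℂ) :
    ‖J.polarPart l w‖ ≤ 2 * ((1 + ‖w‖ + ‖w‖⁻¹) ^ 2 * J.polarNorm l) := by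
  have h1 := norm_nonneg (J.polar₁ l)
  have h2 := norm_nonneg (J.polar₂ l)
  have h3 := norm_nonneg (J.polar₃ l)
  have hs := norm_nonneg w
  have hu : 0 ≤ ‖w‖⁻¹ := by positivity
  set m := (1 + ‖w‖ + ‖w‖⁻¹) ^ 2 with hm
  have key : ∀ x y z : ℂ, ‖x‖ ≤ m → ‖y‖ ≤ m → ‖z‖ ≤ m →
      ‖J.polar₃ l * x + J.polar₂ l * y + J.polar₁ l * z‖ ≤ m * J.polarNorm l := by
    intro x y z hx hy hz
    refine norm_add₃_le.trans ?_
    rw [norm_mul, norm_mul, norm_mul, polarNorm]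
    nlinarith
  have m1 : (1 : ℝ) ≤ m := by nlinarith
  have mw : ‖w‖ ≤ m := by nlinarith
  have mw2 : ‖w ^ 2‖ ≤ m := by rw [norm_pow]; nlinarith
  have mu : ‖w⁻¹‖ ≤ m := by rw [norm_inv]; nlinarith
  have mu2 : ‖w⁻¹ ^ 2‖ ≤ m := by rw [norm_pow, norm_inv]; nlinarith
  have m1' : ‖(1 : ℂ)‖ ≤ m := by rwa [norm_one]
  have k1 := key _ _ _ mu m1' mw
  have k2 := key _ _ _ mu2 mu m1'
  have k3 := key _ _ _ m1' mw mw2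
  simp only [mul_one] at k1 k2 k3
  refine norm_matrix_two_le fun i j => ?_
  fin_cases i <;> fin_cases j
  · exact k1
  · exact k2
  · exact (norm_neg _).trans_le k3
  · exact (norm_neg _).trans_le k1

end PotentialExpansion

/-! ### The monodromy controls the polar part -/

namespace PotentialExpansion

variable {J : PotentialExpansion} {l : ℂ}

theorem hasDerivAt_frame (ζ : ℂ) :
    HasDerivAt (fun ζ => J.frame (Complex.exp (-ζ))) (J.frameDeriv (Complex.exp (-ζ))) ζ := by
  have hw : HasDerivAt (fun ζ => Complex.exp (-ζ)) (-Complex.exp (-ζ)) ζ := by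
    simpa using (hasDerivAt_neg ζ).cexp
  have hu : HasDerivAt (fun ζ => (Complex.exp (-ζ))⁻¹) (Complex.exp (-ζ))⁻¹ ζ := by
    simpa only [Complex.exp_neg, inv_inv] using Complex.hasDerivAt_exp ζ
  refine hasDerivAt_matrix_two fun i j => ?_
  fin_cases i <;> fin_cases j
  · exact (hw.const_mul (1 + J.gaugeCoeff)).congr_deriv (by
      change (1 + J.gaugeCoeff) * -_ = -(1 + J.gaugeCoeff) * _
      ring)
  · exact hasDerivAt_const ζ _
  · exact hasDerivAt_const ζ _
  · exact hu

/-- A primitive of the polar part along `ζ`. -/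
def polarPrimitive (J : PotentialExpansion) (l ζ₀ ζ : ℂ) : Matrix (Fin 2) (Fin 2) ℂ :=
  !![J.polar₃ l * Complex.exp ζ + J.polar₂ l * (ζ - ζ₀) - J.polar₁ l * Complex.exp (-ζ),
    J.polar₃ l * (Complex.exp ζ ^ 2 / 2) + J.polar₂ l * Complex.exp ζ + J.polar₁ l * (ζ - ζ₀);
    -(J.polar₃ l * (ζ - ζ₀) - J.polar₂ l * Complex.exp (-ζ) -
      J.polar₁ l * (Complex.exp (-ζ) ^ 2 / 2)),
    -(J.polar₃ l * Complex.exp ζ + J.polar₂ l * (ζ - ζ₀) - J.polar₁ l * Complex.exp (-ζ))]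

theorem hasDerivAt_polarPrimitive (ζ₀ ζ : ℂ) :
    HasDerivAt (J.polarPrimitive l ζ₀) (J.polarPart l (Complex.exp (-ζ))) ζ := by
  have hw : HasDerivAt (fun ζ => Complex.exp (-ζ)) (-Complex.exp (-ζ)) ζ := by
    simpa using (hasDerivAt_neg ζ).cexp
  have hu := Complex.hasDerivAt_exp ζ
  have hτ : HasDerivAt (fun ζ => ζ - ζ₀) 1 ζ := (hasDerivAt_id ζ).sub_const ζ₀
  have he : (Complex.exp (-ζ))⁻¹ = Complex.exp ζ := by rw [Complex.exp_neg, inv_inv]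
  have h1 : HasDerivAt (fun ζ => J.polar₃ l * Complex.exp ζ + J.polar₂ l * (ζ - ζ₀) -
      J.polar₁ l * Complex.exp (-ζ))
      (J.polar₃ l * (Complex.exp (-ζ))⁻¹ + J.polar₂ l + J.polar₁ l * Complex.exp (-ζ)) ζ :=
    (((hu.const_mul _).add (hτ.const_mul _)).sub (hw.const_mul _)).congr_deriv (by
      rw [he]; ring)
  refine hasDerivAt_matrix_two fun i j => ?_
  fin_cases i <;> fin_cases j
  · exact h1
  · exact ((((hu.pow 2).div_const 2).const_mul _).add (hu.const_mul _)).add (hτ.const_mul _)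
      |>.congr_deriv (by
        change _ = J.polar₃ l * (Complex.exp (-ζ))⁻¹ ^ 2 + J.polar₂ l * (Complex.exp (-ζ))⁻¹ +
          J.polar₁ l
        rw [he]; ring)
  · exact (((hτ.const_mul _).sub (hw.const_mul _)).sub
      (((hw.pow 2).div_const 2).const_mul _)).neg.congr_deriv (by simp [polarPart]; ring)
  · exact h1.neg

/-- The exponentials are `2πi`-periodic, so only the terms linear in `ζ` contribute. The factors
`w`, `1`, `w²` in the entries of the polar part place a different coefficient in each residue, so
that all three are visible. -/
theorem polarPrimitive_sub (ζ₀ : ℂ) :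
    J.polarPrimitive l ζ₀ (ζ₀ + (2 * Real.pi : ℝ) * Complex.I) - J.polarPrimitive l ζ₀ ζ₀ =
      residueMatrix (J.polar₃ l) (J.polar₂ l) (J.polar₁ l) := by
  have h1 : Complex.exp (ζ₀ + (2 * Real.pi : ℝ) * Complex.I) = Complex.exp ζ₀ := by
    push_cast
    exact Complex.exp_periodic ζ₀
  have h2 : Complex.exp (-(ζ₀ + (2 * Real.pi : ℝ) * Complex.I)) = Complex.exp (-ζ₀) := by
    rw [Complex.exp_neg, h1, Complex.exp_neg]
  ext i j
  fin_cases i <;> fin_cases j <;> simp only [polarPrimitive, residueMatrix, h1, h2] <;>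
    simp <;> ring

theorem norm_adjugate_two_le {M : Matrix (Fin 2) (Fin 2) ℂ} {c : ℝ} (h : ∀ i j, ‖M i j‖ ≤ c) :
    ‖M.adjugate‖ ≤ 2 * c := by
  rw [Matrix.adjugate_fin_two]
  refine norm_matrix_two_le fun i j => ?_
  fin_cases i <;> fin_cases j <;> simp <;> apply h

/-- The unitarity of the monodromy controls the polar part of the gauged potential. -/
theorem polarNorm_sq_le_of_monodromy {ζ₀ : ℂ} {r φ : ℝ} (hr : ‖Complex.exp (-ζ₀)‖ < r) :
    ∃ δ₀ > 0, δ₀ ≤ 1 / 2 ∧ ∃ C > 0, ∀ (J : PotentialExpansion) (l : ℂ) (Φ : ℂ → Matrix (Fin 2) (Fin 2) ℂ),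
      ‖l‖ = 1 → J.IsClose r δ₀ → (Φ ζ₀).det = 1 → (∀ i j, ‖Φ ζ₀ i j‖ ≤ φ) →
      (∀ ζ : ℂ, ζ.re = ζ₀.re → ∀ i j, HasDerivAt (fun ζ' => Φ ζ' i j)
        ((Φ ζ * J.potential l (Complex.exp (-ζ))) i j * Complex.exp ζ) ζ) →
      Φ (deckGen ζ₀) * (Φ ζ₀)⁻¹ ∈ Matrix.specialUnitaryGroup (Fin 2) ℂ →
      J.polarNorm l ^ 2 ≤ C * (J.polar₂ l ^ 2 - J.polar₃ l * J.polar₁ l).re ∧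
        J.polarNorm l ≤ C * ‖traceFree (Φ (deckGen ζ₀) * (Φ ζ₀)⁻¹)‖ := by
  set w₀ := Complex.exp (-ζ₀) with hw₀
  have hw₀0 : w₀ ≠ 0 := Complex.exp_ne_zero _
  set s := ‖w₀‖ with hs
  have hs0 : 0 < s := norm_pos_iff.2 hw₀0
  have hr0 : 0 < r := hs0.trans hr
  set f := 3 + 2 * s + s⁻¹ with hf
  have hf0 : 0 < f := by positivity
  -- Bounds both the conjugating matrix `A ζ₀` and its inverse `B`: each is a product of three
  -- factors of norms at most `2|φ|`, `2f` and `2`.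
  set κ := 1 + 8 * |φ| * f with hκ
  have hκ1 : 1 ≤ κ := le_add_of_nonneg_right (by positivity)
  set d := (1 + s + s⁻¹) ^ 2 with hd
  have hd0 : 0 < d := by positivity
  set k := 50 * (1 + r) ^ 2 with hk
  have hk0 : 0 < k := by positivity
  have hcont : ∀ c : ℝ, Tendsto (fun δ : ℝ => c * δ) (𝓝[>] 0) (𝓝 0) := fun c => by
    have : Tendsto (fun δ : ℝ => c * δ) (𝓝 0) (𝓝 (c * 0)) := tendsto_id.const_mul c
    rw [mul_zero] at this
    exact this.mono_left nhdsWithin_le_nhds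
  have hsmall : ∀ c : ℝ, ∀ e : ℝ, 0 < e → ∀ᶠ δ : ℝ in 𝓝[>] 0, c * δ ≤ e := fun c e he =>
    ((hcont c).eventually (gt_mem_nhds he)).mono fun _ h => h.le
  -- The conditions on `δ` ensure in turn `c₀ ≠ 0`, fundamental solutions within `1/2` of the
  -- identity, the bootstrap hypothesis (using `q ≤ 21 δ`), and a final error within the tolerance
  -- `(60 κ⁴)⁻¹`. They are fixed before `J`, `l` and `Φ`, which gives uniformity.
  obtain ⟨δ, hδ0, hδ1, hδ2, hδ3, hδ4⟩ := ((eventually_mem_nhdsWithin (a := (0 : ℝ))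
    (s := Ioi 0)).and ((hsmall 1 (1 / 2) (by norm_num)).and ((hsmall (k * r) (1 / 4)
    (by norm_num)).and ((hsmall (8 * d * 21 * (2 * Real.pi)) (1 / 2) (by norm_num)).and
    (hsmall ((2 * (8 * d) * (2 * Real.pi) * (8 * d) * 21 + 2 * (k * r) * 3 * (2 * d)) *
      (2 * Real.pi)) ((60 * κ ^ 4)⁻¹) (by positivity)))))).exists
  have hδ0' : 0 < δ := hδ0
  rw [one_mul] at hδ1
  refine ⟨δ, hδ0, hδ1, (4 * Real.pi ^ 2 * κ ^ 4) + κ ^ 2, by positivity, ?_⟩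
  intro J l Φ hl hJ hdet hφ hΦ hM
  set q := J.polarNorm l with hq
  have hq0 : 0 ≤ q := by rw [hq, polarNorm]; positivity
  have hq1 : q ≤ 21 * δ := hJ.polarNorm_le hδ1 hl
  obtain ⟨U, V, hV, hUV, hU1, hV1⟩ := exists_fundamentalSolution_ball (η := J.regPart l) hr0
    (δ := k * δ) (by positivity) (by linarith) hJ.differentiableOn_regPart
    (fun w hw => hJ.norm_regPart_le hδ1 hl hw)
  have hbound : ∀ {A : Matrix (Fin 2) (Fin 2) ℂ}, ‖A - 1‖ ≤ 2 * (k * δ * r) → ‖A‖ ≤ 2 := by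
    intro A hA
    calc ‖A‖ = ‖(A - 1) + 1‖ := by rw [sub_add_cancel]
      _ ≤ ‖A - 1‖ + ‖(1 : Matrix (Fin 2) (Fin 2) ℂ)‖ := norm_add_le _ _
      _ ≤ 2 := by rw [Matrix.linfty_opNormOneClass.norm_one]; linarith
  have hwre : ∀ ζ : ℂ, ζ.re = ζ₀.re → ‖Complex.exp (-ζ)‖ = s := by
    intro ζ hζ
    rw [hs, hw₀, Complex.norm_exp, Complex.norm_exp, Complex.neg_re, Complex.neg_re, hζ]
  have hwball : ∀ ζ : ℂ, ζ.re = ζ₀.re → Complex.exp (-ζ) ∈ Metric.ball (0 : ℂ) r :=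
    fun ζ hζ => by rw [mem_ball_zero_iff, hwre ζ hζ]; exact hr
  -- The solution in the new frame, with the regular part removed by `V = U⁻¹`. Its equation is `A'
  -- = A S`, where `S` is linear in the polar part; `B`, the inverse of `A ζ₀`, normalises it at
  -- `ζ₀`.
  set A : ℂ → Matrix (Fin 2) (Fin 2) ℂ := fun ζ =>
    Φ ζ * J.frame (Complex.exp (-ζ)) * V (Complex.exp (-ζ)) with hA
  set B : Matrix (Fin 2) (Fin 2) ℂ := U w₀ * (J.frame w₀).adjugate * (Φ ζ₀).adjugate with hB
  set S : ℂ → Matrix (Fin 2) (Fin 2) ℂ := fun ζ =>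
    U (Complex.exp (-ζ)) * J.polarPart l (Complex.exp (-ζ)) * V (Complex.exp (-ζ)) with hS
  have hVU : ∀ w ∈ Metric.ball (0 : ℂ) r, V w * U w = 1 :=
    fun w hw => mul_eq_one_comm.1 (hUV w hw)
  have hAB : A ζ₀ * B = 1 := by
    have h1 : J.frame w₀ * (J.frame w₀).adjugate = 1 := by
      rw [Matrix.mul_adjugate, det_frame hw₀0, one_smul]
    have h2 : Φ ζ₀ * (Φ ζ₀).adjugate = 1 := by rw [Matrix.mul_adjugate, hdet, one_smul]
    calc A ζ₀ * B = Φ ζ₀ * (J.frame w₀ * ((V w₀ * U w₀) * (J.frame w₀).adjugate)) *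
        (Φ ζ₀).adjugate := by simp only [hA, hB, mul_assoc, ← hw₀]
      _ = 1 := by rw [hVU w₀ (hwball ζ₀ rfl), one_mul, h1, mul_one, h2]
  have hAder : ∀ ζ : ℂ, ζ.re = ζ₀.re → HasDerivAt A (A ζ * S ζ) ζ := by
    intro ζ hζ
    set w := Complex.exp (-ζ) with hw
    have hw0 : w ≠ 0 := Complex.exp_ne_zero _
    have hwb := hwball ζ hζ
    have hwd : HasDerivAt (fun ζ => Complex.exp (-ζ)) (-w) ζ := by
      simpa using (hasDerivAt_neg ζ).cexp
    have hez : Complex.exp ζ = w⁻¹ := by rw [hw, Complex.exp_neg, inv_inv]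
    have h1 : HasDerivAt Φ (Φ ζ * (w⁻¹ • J.potential l w)) ζ :=
      hasDerivAt_matrix_two fun i j => (hΦ ζ hζ i j).congr_deriv (by
        rw [mul_smul_comm, Matrix.smul_apply, smul_eq_mul, hez, mul_comm])
    have h2 := (hV w hwb).scomp ζ hwd
    have h3 := (h1.mul (hasDerivAt_frame (J := J) ζ)).mul h2
    refine h3.congr_deriv ?_
    change (Φ ζ * (w⁻¹ • J.potential l w) * J.frame w + Φ ζ * J.frameDeriv w) * V w +
      Φ ζ * J.frame w * (-w • -(J.regPart l w * V w)) =
      Φ ζ * J.frame w * V w * (U w * J.polarPart l w * V w)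
    have h4 := potential_mul_frame (l := l) (hJ.c₀_ne_zero hδ1) hw0
    calc _ = Φ ζ * (w⁻¹ • (J.potential l w * J.frame w) + J.frameDeriv w) * V w +
          Φ ζ * J.frame w * (w • J.regPart l w) * V w := by
            simp only [mul_add, add_mul, mul_assoc, smul_mul_assoc, mul_smul_comm, smul_neg,
              neg_smul, neg_neg]
      _ = Φ ζ * J.frame w * J.polarPart l w * V w := by
            rw [h4, ← mul_assoc, ← add_mul, ← mul_add, neg_smul]
            congr 2
            abel
      _ = Φ ζ * J.frame w * (V w * U w) * J.polarPart l w * V w := by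
            rw [hVU w hwb, mul_one]
      _ = _ := by simp only [mul_assoc]
  have hpp : ∀ ζ : ℂ, ζ.re = ζ₀.re → ‖J.polarPart l (Complex.exp (-ζ))‖ ≤ 2 * (d * q) := by
    intro ζ hζ
    have := J.norm_polarPart_le l (Complex.exp (-ζ))
    rwa [hwre ζ hζ] at this
  have hSκ : ∀ ζ : ℂ, ζ.re = ζ₀.re → ‖S ζ‖ ≤ 8 * d * q := by
    intro ζ hζ
    have h1 := hbound (hU1 _ (hwball ζ hζ))
    have h2 := hbound (hV1 _ (hwball ζ hζ))
    calc ‖S ζ‖ ≤ ‖U (Complex.exp (-ζ))‖ * ‖J.polarPart l (Complex.exp (-ζ))‖ *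
          ‖V (Complex.exp (-ζ))‖ := (norm_mul_le _ _).trans (by gcongr; exact norm_mul_le _ _)
      _ ≤ 2 * (2 * (d * q)) * 2 := by gcongr; exact hpp ζ hζ
      _ = _ := by ring
  have hSD : ∀ ζ : ℂ, ζ.re = ζ₀.re →
      ‖S ζ - J.polarPart l (Complex.exp (-ζ))‖ ≤ 2 * (k * δ * r) * 3 * (2 * (d * q)) := by
    intro ζ hζ
    have h1 := hU1 _ (hwball ζ hζ)
    have h2 := hV1 _ (hwball ζ hζ)
    have h3 := hbound h2
    have h4 := hpp ζ hζ
    set u := U (Complex.exp (-ζ))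
    set v := V (Complex.exp (-ζ))
    set D := J.polarPart l (Complex.exp (-ζ))
    have h5 : u * D * v - D = (u - 1) * D * v + D * (v - 1) := by noncomm_ring
    change ‖u * D * v - D‖ ≤ _
    rw [h5]
    have h6 : ‖(u - 1) * D * v‖ ≤ 2 * (k * δ * r) * (2 * (d * q)) * 2 :=
      calc _ ≤ ‖u - 1‖ * ‖D‖ * ‖v‖ := (norm_mul_le _ _).trans (by gcongr; exact norm_mul_le _ _)
        _ ≤ _ := by gcongr
    have h7 : ‖D * (v - 1)‖ ≤ (2 * (d * q)) * (2 * (k * δ * r)) :=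
      (norm_mul_le _ _).trans (by gcongr)
    exact (norm_add_le_of_le h6 h7).trans_eq (by ring)
  have hBA : B * A ζ₀ = 1 := mul_eq_one_comm.1 hAB
  have key := norm_sub_one_sub_le_of_hasDerivAt_mul_vertical (T := 2 * Real.pi) (κ := 8 * d * q)
    (μ := 2 * (k * δ * r) * 3 * (2 * (d * q))) (by positivity)
    (by
      calc 8 * d * q * (2 * Real.pi) ≤ 8 * d * (21 * δ) * (2 * Real.pi) := by gcongr
        _ ≤ 1 / 2 := by linarith)
    (N := fun ζ => B * A ζ) (S := S) (P := J.polarPrimitive l ζ₀)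
    (D := fun ζ => J.polarPart l (Complex.exp (-ζ))) (ζ₀ := ζ₀) hBA
    (fun ζ hζ => by
      rw [mul_assoc]
      exact (hAder ζ hζ).const_mul B)
    (fun ζ _ => hasDerivAt_polarPrimitive ζ₀ ζ) hSκ hSD
  rw [polarPrimitive_sub] at key
  have hdeck : ζ₀ + (2 * Real.pi : ℝ) * Complex.I = deckGen ζ₀ := by
    rw [deckGen]; push_cast; rfl
  rw [hdeck] at key
  have hexpdeck : Complex.exp (-deckGen ζ₀) = w₀ := by
    rw [deckGen, Complex.exp_neg, Complex.exp_periodic ζ₀, hw₀, Complex.exp_neg]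
  have hinv : (Φ ζ₀)⁻¹ = (Φ ζ₀).adjugate := by simp [Matrix.inv_def, hdet]
  -- The frame and `V` depend on `ζ` only through `w = exp (-ζ)`, so they are single-valued and
  -- contribute no monodromy.
  have hMN : Φ (deckGen ζ₀) * (Φ ζ₀)⁻¹ = A ζ₀ * (B * A (deckGen ζ₀)) * B := by
    have h1 : J.frame w₀ * (J.frame w₀).adjugate = 1 := by
      rw [Matrix.mul_adjugate, det_frame hw₀0, one_smul]
    calc Φ (deckGen ζ₀) * (Φ ζ₀)⁻¹
        = Φ (deckGen ζ₀) * (J.frame w₀ * ((V w₀ * U w₀) * (J.frame w₀).adjugate)) *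
          (Φ ζ₀).adjugate := by rw [hVU w₀ (hwball ζ₀ rfl), one_mul, h1, mul_one, hinv]
      _ = A (deckGen ζ₀) * B := by simp only [hA, hB, mul_assoc, hexpdeck]
      _ = _ := by rw [← mul_assoc (A ζ₀), hAB, one_mul]
  have hfr : ∀ i j, ‖J.frame w₀ i j‖ ≤ f := fun i j => hJ.norm_frame_le hδ1
  have hφ' : ∀ i j, ‖Φ ζ₀ i j‖ ≤ |φ| := fun i j => (hφ i j).trans (le_abs_self φ)
  have hAκ : ‖A ζ₀‖ ≤ κ := by
    have h2 := hbound (hV1 _ (hwball ζ₀ rfl))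
    calc ‖A ζ₀‖ ≤ ‖Φ ζ₀‖ * ‖J.frame w₀‖ * ‖V w₀‖ :=
          (norm_mul_le _ _).trans (by gcongr; exact norm_mul_le _ _)
      _ ≤ (2 * |φ|) * (2 * f) * 2 := by
          gcongr
          · exact norm_matrix_two_le hφ'
          · exact norm_matrix_two_le hfr
      _ ≤ κ := by rw [hκ]; linarith
  have hBκ : ‖B‖ ≤ κ := by
    have h2 := hbound (hU1 _ (hwball ζ₀ rfl))
    calc ‖B‖ ≤ ‖U w₀‖ * ‖(J.frame w₀).adjugate‖ * ‖(Φ ζ₀).adjugate‖ :=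
          (norm_mul_le _ _).trans (by gcongr; exact norm_mul_le _ _)
      _ ≤ 2 * (2 * f) * (2 * |φ|) := by
          gcongr
          · exact norm_adjugate_two_le hfr
          · exact norm_adjugate_two_le hφ'
      _ ≤ κ := by rw [hκ]; linarith
  -- In the term quadratic in `q`, one factor is replaced by its bound `21 δ`, leaving an error that
  -- is `O(δ) q`.
  have hfin : (2 * (8 * d * q) * (2 * Real.pi) * (8 * d * q) +
      2 * (k * δ * r) * 3 * (2 * (d * q))) * (2 * Real.pi) ≤ (60 * κ ^ 4)⁻¹ * q := by
    calc _ ≤ (2 * (8 * d * (21 * δ)) * (2 * Real.pi) * (8 * d * q) +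
          2 * (k * δ * r) * 3 * (2 * (d * q))) * (2 * Real.pi) := by gcongr
      _ = ((2 * (8 * d) * (2 * Real.pi) * (8 * d) * 21 + 2 * (k * r) * 3 * (2 * d)) *
          (2 * Real.pi)) * δ * q := by ring
      _ ≤ _ := by gcongr
  obtain ⟨h1, h2⟩ := coercive_of_conj_mem_specialUnitaryGroup hκ1 hAB hAκ hBκ hMN hM
    (key.trans hfin)
  have hp0 : 0 ≤ (J.polar₂ l ^ 2 - J.polar₃ l * J.polar₁ l).re := by
    have h3 : 0 < 4 * Real.pi ^ 2 * κ ^ 4 := by positivity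
    exact nonneg_of_mul_nonneg_right ((sq_nonneg _).trans h1) h3
  refine ⟨h1.trans ?_, h2.trans ?_⟩
  · rw [add_mul]
    exact le_add_of_nonneg_right (by positivity)
  · rw [add_mul]
    exact le_add_of_nonneg_left (by positivity)

end PotentialExpansion

/-! ### Vanishing from a coercive quadratic form on the unit circle -/

section UnitCircle

theorem accPt_unitCircle : AccPt (1 : ℂ) (𝓟 (Metric.sphere 0 1)) := by
  have h1 : IsPreconnected (Metric.sphere (0 : ℂ) 1) :=
    isPreconnected_sphere (by simp [Complex.rank_real_complex]) 0 1
  exact h1.preperfect_of_nontrivial ⟨1, by simp, -1, by simp, by norm_num⟩ 1 (by simp)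

variable {ρ : ℝ}

theorem mem_ball_of_norm_eq_one (hρ : 1 < ρ) {l : ℂ} (hl : ‖l‖ = 1) :
    l ∈ Metric.ball (0 : ℂ) ρ := by
  rw [mem_ball_zero_iff, hl]; exact hρ

theorem eqOn_ball_of_eqOn_unitCircle (hρ : 1 < ρ) {f g : ℂ → ℂ}
    (hf : DifferentiableOn ℂ f (Metric.ball 0 ρ)) (hg : DifferentiableOn ℂ g (Metric.ball 0 ρ))
    (h : ∀ l : ℂ, ‖l‖ = 1 → f l = g l) : EqOn f g (Metric.ball 0 ρ) := by
  refine (hf.analyticOnNhd Metric.isOpen_ball).eqOn_of_preconnected_of_frequently_eq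
    (hg.analyticOnNhd Metric.isOpen_ball) (convex_ball _ _).isPreconnected
    (mem_ball_of_norm_eq_one hρ norm_one) ?_
  exact (accPt_iff_frequently_nhdsNE.1 accPt_unitCircle).mono fun l hl => h l (by simpa using hl)

/-- A function that vanishes to second order at `1` along the unit circle is divisible by
`(λ - 1)²`. -/
theorem exists_eq_sub_one_sq_mul (hρ : 1 < ρ) {f : ℂ → ℂ}
    (hf : DifferentiableOn ℂ f (Metric.ball 0 ρ))
    (ho : f =o[𝓝[Metric.sphere 0 1] 1] fun l => l - 1) :
    ∃ h : ℂ → ℂ, DifferentiableOn ℂ h (Metric.ball 0 ρ) ∧ ∀ l, f l = (l - 1) ^ 2 * h l := by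
  have hnhds : Metric.ball (0 : ℂ) ρ ∈ 𝓝 1 :=
    Metric.isOpen_ball.mem_nhds (mem_ball_of_norm_eq_one hρ norm_one)
  have h1 : (1 : ℂ) ∈ Metric.sphere (0 : ℂ) 1 := by simp
  have hf1 : f 1 = 0 := by
    have := (ho.bound one_pos).self_of_nhdsWithin h1
    simpa using this
  have hd : HasDerivWithinAt f 0 (Metric.sphere 0 1) 1 := by
    rw [hasDerivWithinAt_iff_isLittleO]
    simpa [hf1] using ho
  -- The derivative along the circle determines the complex derivative, because `1` is an
  -- accumulation point of the circle.
  have hderiv : deriv f 1 = 0 :=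
    (uniqueDiffWithinAt_iff_accPt.2 accPt_unitCircle).eq_deriv _
      (hf.differentiableAt hnhds).hasDerivAt.hasDerivWithinAt hd
  have hg := (Complex.differentiableOn_dslope hnhds).2 hf
  refine ⟨dslope (dslope f 1) 1, (Complex.differentiableOn_dslope hnhds).2 hg, fun l => ?_⟩
  have e1 := sub_smul_dslope f 1 l
  have e2 := sub_smul_dslope (dslope f 1) 1 l
  rw [dslope_same, hderiv, sub_zero, smul_eq_mul] at e2
  rw [hf1, sub_zero, smul_eq_mul] at e1
  rw [← e1, ← e2]; ring

/-- If the quadratic form `y² - x z` of three holomorphic functions on a disc controls them on the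
unit circle, up to the factor `λ⁻²`, if they vanish to second order at `1`, and if the form has
nonpositive real part at `0`, then the functions vanish. -/
theorem eqOn_zero_of_quadratic_coercive (hρ : 1 < ρ) {x y z : ℂ → ℂ} {C : ℝ} (hC0 : 0 < C)
    (hx : DifferentiableOn ℂ x (Metric.ball 0 ρ)) (hy : DifferentiableOn ℂ y (Metric.ball 0 ρ))
    (hz : DifferentiableOn ℂ z (Metric.ball 0 ρ))
    (hxo : x =o[𝓝[Metric.sphere 0 1] 1] fun l => l - 1)
    (hyo : y =o[𝓝[Metric.sphere 0 1] 1] fun l => l - 1)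
    (hzo : z =o[𝓝[Metric.sphere 0 1] 1] fun l => l - 1)
    (hC : ∀ l : ℂ, ‖l‖ = 1 →
      (‖x l‖ + ‖y l‖ + ‖z l‖) ^ 2 ≤ C * ((l⁻¹ * y l) ^ 2 - l⁻¹ * x l * (l⁻¹ * z l)).re)
    (h0 : (y 0 ^ 2 - x 0 * z 0).re ≤ 0) :
    ∀ l ∈ Metric.ball (0 : ℂ) ρ, x l = 0 ∧ y l = 0 ∧ z l = 0 := by
  obtain ⟨u, hu, hxu⟩ := exists_eq_sub_one_sq_mul hρ hx hxo
  obtain ⟨v, hv, hyv⟩ := exists_eq_sub_one_sq_mul hρ hy hyo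
  obtain ⟨w, hw, hzw⟩ := exists_eq_sub_one_sq_mul hρ hz hzo
  set F : ℂ → ℂ := fun l => v l ^ 2 - u l * w l with hF
  have hFd : DifferentiableOn ℂ F (Metric.ball 0 ρ) := (hv.pow 2).sub (hu.mul hw)
  have hne : ∀ l : ℂ, ‖l‖ = 1 → l ≠ 1 → (‖u l‖ + ‖v l‖ + ‖w l‖) ^ 2 ≤ C * (F l).re := by
    intro l hl hl1
    have hl0 : l ≠ 0 := norm_pos_iff.1 (by rw [hl]; norm_num)
    have hs : 0 < ‖l - 1‖ := norm_pos_iff.2 (sub_ne_zero.2 hl1)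
    -- The key reality: since this factor is real, its square comes out of the real part, and both
    -- sides of the estimate can be divided by `‖l - 1‖⁴`.
    have hsq : l⁻¹ * (l - 1) ^ 2 = -((‖l - 1‖ ^ 2 : ℝ) : ℂ) := by
      have h1 : l⁻¹ = (starRingEnd ℂ) l := Complex.inv_eq_conj hl
      have h2 : (starRingEnd ℂ) l * l = 1 := by rw [← h1, inv_mul_cancel₀ hl0]
      have h3 : ((‖l - 1‖ ^ 2 : ℝ) : ℂ) = (l - 1) * (starRingEnd ℂ) (l - 1) := by
        rw [Complex.mul_conj, Complex.normSq_eq_norm_sq]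
      rw [h1, h3, map_sub, map_one]
      linear_combination (l - 1) * h2
    have hform : (l⁻¹ * y l) ^ 2 - l⁻¹ * x l * (l⁻¹ * z l) = ((‖l - 1‖ ^ 4 : ℝ) : ℂ) * F l := by
      have : ((‖l - 1‖ ^ 4 : ℝ) : ℂ) = (l⁻¹ * (l - 1) ^ 2) ^ 2 := by
        rw [hsq]; push_cast; ring
      rw [this, hxu, hyv, hzw, hF]; ring
    have h := hC l hl
    rw [hform, Complex.re_ofReal_mul, hxu, hyv, hzw, norm_mul, norm_mul, norm_mul, norm_pow] at h
    have h4 : 0 < ‖l - 1‖ ^ 4 := by positivity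
    refine le_of_mul_le_mul_left ?_ h4
    linarith
  -- The point `1`, excluded by the division, is recovered by continuity along the circle.
  have hall : ∀ l : ℂ, ‖l‖ = 1 → (‖u l‖ + ‖v l‖ + ‖w l‖) ^ 2 ≤ C * (F l).re := by
    intro l hl
    rcases eq_or_ne l 1 with rfl | hl1
    · have hnhds : Metric.ball (0 : ℂ) ρ ∈ 𝓝 1 :=
        Metric.isOpen_ball.mem_nhds (mem_ball_of_norm_eq_one hρ norm_one)
      have cu := (hu.differentiableAt hnhds).continuousAt
      have cv := (hv.differentiableAt hnhds).continuousAt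
      have cw := (hw.differentiableAt hnhds).continuousAt
      have cF := (hFd.differentiableAt hnhds).continuousAt
      have hbot : (𝓝[≠] (1 : ℂ) ⊓ 𝓟 (Metric.sphere 0 1)).NeBot := accPt_unitCircle
      have hle : 𝓝[≠] (1 : ℂ) ⊓ 𝓟 (Metric.sphere 0 1) ≤ 𝓝 1 := inf_le_left.trans inf_le_left
      refine le_of_tendsto_of_tendsto
        (((cu.norm.add cv.norm).add cw.norm).pow 2 |>.tendsto.mono_left hle)
        ((Complex.continuous_re.continuousAt.comp cF).const_mul C |>.mono_left hle) ?_
      refine eventually_inf_principal.2 (eventually_nhdsWithin_of_forall fun l hl hl' => ?_)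
      exact hne l (by simpa using hl') hl
    · exact hne l hl hl1
  have hclosed : Metric.closedBall (0 : ℂ) 1 ⊆ Metric.ball 0 ρ :=
    Metric.closedBall_subset_ball hρ
  have hre : ∀ l : ℂ, ‖l‖ = 1 → ‖u l‖ + ‖v l‖ + ‖w l‖ = 0 := by
    have hF0 : (F 0).re ≤ 0 := by
      have e : F 0 = y 0 ^ 2 - x 0 * z 0 := by rw [hxu, hyv, hzw, hF]; ring
      rwa [e]
    -- The modulus `exp (-Re F)` is at most `1` on the circle and at least `1` at the centre, so it
    -- is identically `1` on the closed disc and `Re F = 0`.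
    have hE : DiffContOnCl ℂ (fun l => Complex.exp (-F l)) (Metric.ball 0 1) :=
      hFd.neg.cexp.diffContOnCl_ball hclosed
    have hEn : ∀ l, ‖Complex.exp (-F l)‖ = Real.exp (-(F l).re) := fun l => by
      rw [Complex.norm_exp, Complex.neg_re]
    have hE1 : ∀ l ∈ closure (Metric.ball (0 : ℂ) 1), ‖Complex.exp (-F l)‖ ≤ 1 := by
      intro l hl
      refine Complex.norm_le_of_forall_mem_frontier_norm_le Metric.isBounded_ball hE ?_ hl
      rw [frontier_ball _ one_ne_zero]
      intro l hl
      rw [hEn, Real.exp_le_one_iff, neg_nonpos]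
      have := hall l (by simpa using hl)
      exact nonneg_of_mul_nonneg_right ((sq_nonneg _).trans this) hC0
    have hE0 : 1 ≤ ‖Complex.exp (-F 0)‖ := by
      rw [hEn, Real.one_le_exp_iff]; linarith
    have hmax : IsMaxOn (norm ∘ fun l => Complex.exp (-F l)) (Metric.ball 0 1) 0 :=
      fun l hl => (hE1 l (subset_closure hl)).trans hE0
    intro l hl
    have h1 := Complex.norm_eqOn_closedBall_of_isMaxOn hE hmax
      (show l ∈ Metric.closedBall (0 : ℂ) 1 by simpa using hl.le)
    have h2 : 1 ≤ ‖Complex.exp (-F l)‖ := hE0.trans_eq h1.symm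
    rw [hEn, Real.one_le_exp_iff] at h2
    have h3 := hall l hl
    have h4 : (‖u l‖ + ‖v l‖ + ‖w l‖) ^ 2 ≤ 0 := h3.trans (by nlinarith)
    exact pow_eq_zero_iff two_ne_zero |>.1 (le_antisymm h4 (sq_nonneg _))
  have hzero : ∀ {f h : ℂ → ℂ}, DifferentiableOn ℂ f (Metric.ball 0 ρ) →
      (∀ l, f l = (l - 1) ^ 2 * h l) → (∀ l : ℂ, ‖l‖ = 1 → h l = 0) →
      ∀ l ∈ Metric.ball (0 : ℂ) ρ, f l = 0 := fun hf hfh hh =>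
    eqOn_ball_of_eqOn_unitCircle hρ hf (differentiableOn_const 0)
      fun l hl => by rw [hfh, hh l hl, mul_zero]
  have hnorm : ∀ l : ℂ, ‖l‖ = 1 → u l = 0 ∧ v l = 0 ∧ w l = 0 := by
    intro l hl
    have h := hre l hl
    have h1 := norm_nonneg (u l)
    have h2 := norm_nonneg (v l)
    have h3 := norm_nonneg (w l)
    exact ⟨norm_eq_zero.1 (by linarith), norm_eq_zero.1 (by linarith),
      norm_eq_zero.1 (by linarith)⟩
  exact fun l hl => ⟨hzero hx hxu (fun l hl => (hnorm l hl).1) l hl,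
    hzero hy hyv (fun l hl => (hnorm l hl).2.1) l hl,
    hzero hz hzw (fun l hl => (hnorm l hl).2.2) l hl⟩

end UnitCircle

/-! ### From holomorphic functions to expansions -/

namespace PotentialExpansion

/-- The expansion of the potential with `α = w A(w)`, `β = w B(w)`, `γ = C(w)`. -/
def ofFunctions (A B C : ℂ → ℂ) : PotentialExpansion where
  a₀ := A 0
  a₁ := dslope A 0 0
  b₀ := B 0
  b₁ := dslope B 0 0
  b₂ := dslope (dslope B 0) 0 0
  c₀ := C 0
  c₁ := dslope C 0 0
  a := dslope (dslope A 0) 0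
  b := dslope (dslope (dslope B 0) 0) 0
  c := dslope (dslope C 0) 0

theorem potential_ofFunctions (A B C : ℂ → ℂ) (l w : ℂ) :
    (ofFunctions A B C).potential l w = !![w * A w, l⁻¹ * (w * B w); C w, -(w * A w)] := by
  have h1 : (ofFunctions A B C).alpha w = w * A w := by
    rw [eq_add_smul_dslope A w, eq_add_smul_dslope (dslope A 0) w]; rfl
  have h2 : (ofFunctions A B C).beta w = w * B w := by
    rw [eq_add_smul_dslope B w, eq_add_smul_dslope (dslope B 0) w,
      eq_add_smul_dslope (dslope (dslope B 0) 0) w]; rfl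
  have h3 : (ofFunctions A B C).gamma w = C w := by
    rw [eq_add_smul_dslope C w, eq_add_smul_dslope (dslope C 0) w]; rfl
  rw [potential, h1, h2, h3]

/-- Each slope costs a factor `2 / r` and at most three are taken, so `(1 + 2 / r)³` dominates every
loss. -/
theorem isClose_ofFunctions {A B C : ℂ → ℂ} {R r δ : ℝ} (hr : 0 < r) (hrR : r < R)
    (hA : DifferentiableOn ℂ A (Metric.ball 0 R)) (hB : DifferentiableOn ℂ B (Metric.ball 0 R))
    (hC : DifferentiableOn ℂ C (Metric.ball 0 R))
    (hAδ : ∀ w ∈ Metric.sphere (0 : ℂ) r, ‖A w‖ ≤ δ)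
    (hBδ : ∀ w ∈ Metric.sphere (0 : ℂ) r, ‖B w‖ ≤ δ)
    (hCδ : ∀ w ∈ Metric.sphere (0 : ℂ) r, ‖C w - 1‖ ≤ δ) :
    (ofFunctions A B C).IsClose r ((1 + 2 / r) ^ 3 * δ) := by
  have hR := hr.trans hrR
  have h0 : (0 : ℂ) ∈ Metric.closedBall (0 : ℂ) r := Metric.mem_closedBall_self hr.le
  have hδ : 0 ≤ δ := (norm_nonneg _).trans (norm_le_of_norm_le_sphere hr hrR hA hAδ h0)
  have hp : 0 ≤ 2 / r := by positivity
  have e1 : δ ≤ (1 + 2 / r) ^ 3 * δ := le_mul_of_one_le_left hδ (one_le_pow₀ (by linarith))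
  have e2 : 2 * δ / r ≤ (1 + 2 / r) ^ 3 * δ := by
    rw [mul_div_right_comm]; gcongr; nlinarith [mul_nonneg hp hp, mul_nonneg (mul_nonneg hp hp) hp]
  have e3 : 2 * (2 * δ / r) / r ≤ (1 + 2 / r) ^ 3 * δ := by
    rw [show 2 * (2 * δ / r) / r = (2 / r) ^ 2 * δ by ring]; gcongr
    nlinarith [mul_nonneg hp hp, mul_nonneg (mul_nonneg hp hp) hp]
  have e4 : 2 * (2 * (2 * δ / r) / r) / r ≤ (1 + 2 / r) ^ 3 * δ := by
    rw [show 2 * (2 * (2 * δ / r) / r) / r = (2 / r) ^ 3 * δ by ring]; gcongr; linarith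
  have step : ∀ {f : ℂ → ℂ} {e : ℝ}, DifferentiableOn ℂ f (Metric.ball 0 R) →
      (∀ w ∈ Metric.closedBall (0 : ℂ) r, ‖f w‖ ≤ e) →
      ∀ w ∈ Metric.closedBall (0 : ℂ) r, ‖dslope f 0 w‖ ≤ 2 * e / r := fun hf hfe =>
    norm_dslope_zero_le 0 hr hrR hf fun w hw => by
      rw [sub_zero]; exact hfe w (Metric.sphere_subset_closedBall hw)
  have hA0 := fun w hw => norm_le_of_norm_le_sphere hr hrR hA hAδ (w := w) hw
  have hA1 := step hA hA0
  have hA2 := step (hA.dslope_zero hR) hA1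
  have hB0 := fun w hw => norm_le_of_norm_le_sphere hr hrR hB hBδ (w := w) hw
  have hB1 := step hB hB0
  have hB2 := step (hB.dslope_zero hR) hB1
  have hB3 := step ((hB.dslope_zero hR).dslope_zero hR) hB2
  have hC0 := norm_le_of_norm_le_sphere hr hrR (hC.sub_const 1) hCδ h0
  have hC1 := norm_dslope_zero_le 1 hr hrR hC hCδ
  have hC2 := step (hC.dslope_zero hR) hC1
  have hsub : Metric.ball (0 : ℂ) r ⊆ Metric.ball 0 R := Metric.ball_subset_ball hrR.le
  have hcl : ∀ w ∈ Metric.ball (0 : ℂ) r, w ∈ Metric.closedBall (0 : ℂ) r :=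
    fun w hw => Metric.ball_subset_closedBall hw
  exact
    { a₀ := (hA0 0 h0).trans e1
      a₁ := (hA1 0 h0).trans e2
      b₀ := (hB0 0 h0).trans e1
      b₁ := (hB1 0 h0).trans e2
      b₂ := (hB2 0 h0).trans e3
      c₀ := hC0.trans e1
      c₁ := (hC1 0 h0).trans e2
      a := fun w hw => (hA2 w (hcl w hw)).trans e3
      b := fun w hw => (hB3 w (hcl w hw)).trans e4
      c := fun w hw => (hC2 w (hcl w hw)).trans e3
      differentiableOn_a := ((hA.dslope_zero hR).dslope_zero hR).mono hsub
      differentiableOn_b := (((hB.dslope_zero hR).dslope_zero hR).dslope_zero hR).mono hsub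
      differentiableOn_c := ((hC.dslope_zero hR).dslope_zero hR).mono hsub }

variable {J : PotentialExpansion} {l w : ℂ}

/-- The `z`-derivative of the gauge `(w, g; 0, w⁻¹)` is `diag (-w², 1)`, and `-w⁻²` converts `dz` to
`dw`. Vanishing of the polar coefficients allows `b₀, b₁, b₂` to be eliminated, after which no
negative power of `w` remains. -/
theorem gauge_potential (hc : J.c₀ ≠ 0) (hw : w ≠ 0) (h₁ : J.polar₁ l = 0) (h₂ : J.polar₂ l = 0)
    (h₃ : J.polar₃ l = 0) :
    (-(w ^ 2)⁻¹) • (!![w⁻¹, -J.gaugeCoeff; 0, w] * J.potential l w *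
        !![w, J.gaugeCoeff; 0, w⁻¹] +
      !![w⁻¹, -J.gaugeCoeff; 0, w] * !![-w ^ 2, 0; 0, 1]) =
      !![J.regDiag w, -J.regUpper l w; -J.gamma w, -J.regDiag w] := by
  have hg : J.gaugeCoeff * J.c₀ = J.a₀ - 1 := div_mul_cancel₀ _ hc
  have ha : J.a₀ = J.gaugeCoeff * J.c₀ + 1 := by rw [hg]; ring
  rw [polar₁] at h₁
  rw [polar₂] at h₂
  have hb₀ : l⁻¹ * J.b₀ = 0 := h₃
  have hb₁ : l⁻¹ * J.b₁ = -J.gaugeCoeff * (J.gaugeCoeff * J.c₀ + 1) := by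
    rw [← ha]; linear_combination h₂
  have hb₂ : l⁻¹ * J.b₂ = -2 * J.gaugeCoeff * J.a₁ + J.gaugeCoeff ^ 2 * J.c₁ := by
    linear_combination h₁
  have hβ : l⁻¹ * J.beta w = w * (l⁻¹ * J.b₀ + w * (l⁻¹ * J.b₁ + w * (l⁻¹ * J.b₂ +
      w * (l⁻¹ * J.b w)))) := by rw [beta]; ring
  rw [hb₀, hb₁, hb₂] at hβ
  ext i j
  fin_cases i <;> fin_cases j <;>
    simp [potential, hβ, ha, alpha, gamma, regDiag, regUpper] <;>
    generalize J.gaugeCoeff = g <;> field_simp <;> ring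

end PotentialExpansion

open PotentialExpansion Wiener

/-! ### Dependence on `λ` and construction of the gauge -/

section Family

variable {ρ R : ℝ}

/-- The expansion at `∞`, at the value `l` of `λ`, of the potential with `α = w A(w)`,
`β = w B(w)` and `γ = C(w)`. -/
def expansionAt (A B C : ℂ → Wiener ρ) (l : ℂ) : PotentialExpansion :=
  ofFunctions (evalNonneg ρ l ∘ A) (evalNonneg ρ l ∘ B) (evalNonneg ρ l ∘ C)

/-- Evaluation is linear and continuous. The Taylor data at `λ` are therefore evaluations of
`𝓦`-valued Taylor data, and so holomorphic in `λ`. -/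
theorem dslope_evalNonneg_comp (hR : 0 < R) {A : ℂ → Wiener ρ}
    (hA : DifferentiableOn ℂ A (Metric.ball 0 R)) (l : ℂ) :
    dslope (evalNonneg ρ l ∘ A) 0 = evalNonneg ρ l ∘ dslope A 0 := by
  funext w
  exact (evalNonneg ρ l).dslope_comp A 0 w fun _ =>
    hA.differentiableAt (Metric.ball_mem_nhds 0 hR)

theorem loopMatrix_eq_potential (hρ : 1 < ρ) {A B C : ℂ → Wiener ρ} {l w : ℂ} {a b c : Wiener ρ}
    (ha : a.IsNonneg) (hb : b.IsNonneg) (hc : c.IsNonneg) (hA : a = w • A w) (hB : b = w • B w)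
    (hC : c = C w) (hl : ‖l‖ < ρ) :
    loopMatrix a b c l = (expansionAt A B C l).potential l w := by
  rw [expansionAt, potential_ofFunctions, loopMatrix, ha.eval_eq hρ hl, hb.eval_eq hρ hl,
    hc.eval_eq hρ hl, hA, hB, hC]
  simp

theorem differentiableOn_evalNonneg_apply (hρ : 1 < ρ) (f : Wiener ρ) :
    DifferentiableOn ℂ (fun l => evalNonneg ρ l f) (Metric.ball 0 ρ) :=
  (differentiableOn_evalNonneg hρ).clm_apply (differentiableOn_const f)

theorem differentiableOn_evalNonneg_uncurry (hρ : 1 < ρ) {A : ℂ → Wiener ρ}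
    (hA : DifferentiableOn ℂ A (Metric.ball 0 R)) :
    DifferentiableOn ℂ (fun p : ℂ × ℂ => evalNonneg ρ p.2 (A p.1))
      (Metric.ball 0 R ×ˢ Metric.ball 0 ρ) :=
  ((differentiableOn_evalNonneg hρ).comp differentiableOn_snd fun _ hp => hp.2).clm_apply
    (hA.comp differentiableOn_fst fun _ hp => hp.1)

variable {A B C : ℂ → Wiener ρ}

theorem differentiableOn_coeffs (hρ : 1 < ρ) (hR : 0 < R)
    (hA : DifferentiableOn ℂ A (Metric.ball 0 R)) (hB : DifferentiableOn ℂ B (Metric.ball 0 R))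
    (hC : DifferentiableOn ℂ C (Metric.ball 0 R)) :
    (DifferentiableOn ℂ (fun l => (expansionAt A B C l).a₀) (Metric.ball 0 ρ) ∧
      DifferentiableOn ℂ (fun l => (expansionAt A B C l).a₁) (Metric.ball 0 ρ)) ∧
    (DifferentiableOn ℂ (fun l => (expansionAt A B C l).b₀) (Metric.ball 0 ρ) ∧
      DifferentiableOn ℂ (fun l => (expansionAt A B C l).b₁) (Metric.ball 0 ρ) ∧
      DifferentiableOn ℂ (fun l => (expansionAt A B C l).b₂) (Metric.ball 0 ρ)) ∧
    DifferentiableOn ℂ (fun l => (expansionAt A B C l).c₀) (Metric.ball 0 ρ) ∧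
      DifferentiableOn ℂ (fun l => (expansionAt A B C l).c₁) (Metric.ball 0 ρ) := by
  have hB1 := hB.dslope_zero hR
  have h := fun f : Wiener ρ => differentiableOn_evalNonneg_apply hρ f
  simp only [expansionAt, ofFunctions, dslope_evalNonneg_comp hR hA, dslope_evalNonneg_comp hR hB,
    dslope_evalNonneg_comp hR hB1, dslope_evalNonneg_comp hR hC, Function.comp_apply]
  exact ⟨⟨h _, h _⟩, ⟨h _, h _, h _⟩, h _, h _⟩

theorem differentiableOn_remainders (hρ : 1 < ρ) (hR : 0 < R)
    (hA : DifferentiableOn ℂ A (Metric.ball 0 R)) (hB : DifferentiableOn ℂ B (Metric.ball 0 R))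
    (hC : DifferentiableOn ℂ C (Metric.ball 0 R)) :
    DifferentiableOn ℂ (fun p : ℂ × ℂ => (expansionAt A B C p.2).a p.1)
      (Metric.ball 0 R ×ˢ Metric.ball 0 ρ) ∧
    DifferentiableOn ℂ (fun p : ℂ × ℂ => (expansionAt A B C p.2).b p.1)
      (Metric.ball 0 R ×ˢ Metric.ball 0 ρ) ∧
    DifferentiableOn ℂ (fun p : ℂ × ℂ => (expansionAt A B C p.2).c p.1)
      (Metric.ball 0 R ×ˢ Metric.ball 0 ρ) := by
  have hA1 := hA.dslope_zero hR
  have hB1 := hB.dslope_zero hR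
  have hB2 := hB1.dslope_zero hR
  have hC1 := hC.dslope_zero hR
  simp only [expansionAt, ofFunctions, dslope_evalNonneg_comp hR hA, dslope_evalNonneg_comp hR hB,
    dslope_evalNonneg_comp hR hA1, dslope_evalNonneg_comp hR hB1, dslope_evalNonneg_comp hR hB2,
    dslope_evalNonneg_comp hR hC, dslope_evalNonneg_comp hR hC1, Function.comp_apply]
  exact ⟨differentiableOn_evalNonneg_uncurry hρ (hA1.dslope_zero hR),
    differentiableOn_evalNonneg_uncurry hρ (hB2.dslope_zero hR),
    differentiableOn_evalNonneg_uncurry hρ (hC1.dslope_zero hR)⟩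

theorem differentiableOn_gaugeCoeff (hρ : 1 < ρ) (hR : 0 < R)
    (hA : DifferentiableOn ℂ A (Metric.ball 0 R)) (hB : DifferentiableOn ℂ B (Metric.ball 0 R))
    (hC : DifferentiableOn ℂ C (Metric.ball 0 R))
    (hc : ∀ l ∈ Metric.ball (0 : ℂ) ρ, (expansionAt A B C l).c₀ ≠ 0) :
    DifferentiableOn ℂ (fun l => (expansionAt A B C l).gaugeCoeff) (Metric.ball 0 ρ) := by
  obtain ⟨⟨ha, -⟩, -, hc₀, -⟩ := differentiableOn_coeffs hρ hR hA hB hC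
  exact (ha.sub_const 1).div hc₀ hc

/-- If the polar part of the gauged potential vanishes then `∞` is a removable singularity. -/
theorem exists_gauge_of_polar_eq_zero (hρ : 1 < ρ) (hR : 0 < R)
    (hA : DifferentiableOn ℂ A (Metric.ball 0 R)) (hB : DifferentiableOn ℂ B (Metric.ball 0 R))
    (hC : DifferentiableOn ℂ C (Metric.ball 0 R))
    (hc : ∀ l ∈ Metric.ball (0 : ℂ) ρ, (expansionAt A B C l).c₀ ≠ 0)
    (hpolar : ∀ l ∈ Metric.ball (0 : ℂ) ρ, l ≠ 0 → (expansionAt A B C l).polar₃ l = 0 ∧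
      (expansionAt A B C l).polar₂ l = 0 ∧ (expansionAt A B C l).polar₁ l = 0)
    {ξ : ℂ → ℂ → Matrix (Fin 2) (Fin 2) ℂ}
    (hξ : ∀ w ∈ Metric.ball (0 : ℂ) R, w ≠ 0 → ∀ l ∈ Metric.ball (0 : ℂ) ρ,
      ξ w⁻¹ l = (expansionAt A B C l).potential l w) :
    ∃ G : ℂ → ℂ → Matrix (Fin 2) (Fin 2) ℂ, IsGauge ρ (puncturedDiscInfty R) G ∧
      ExtendsHolomorphicallyAtInfty ρ (gaugeAction ξ G) := by
  have hg := differentiableOn_gaugeCoeff hρ hR hA hB hC hc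
  have hz0 : ∀ z ∈ puncturedDiscInfty R, z ≠ 0 := fun z hz =>
    norm_pos_iff.1 ((inv_pos.2 hR).trans hz)
  refine ⟨fun z l => !![z⁻¹, (expansionAt A B C l).gaugeCoeff; 0, z], ⟨?_, ?_, ?_⟩, R, hR, ?_⟩
  · intro i j
    fin_cases i <;> fin_cases j
    · exact differentiableOn_fst.inv fun p hp => hz0 p.1 hp.1
    · exact hg.comp differentiableOn_snd fun p hp => hp.2
    · exact differentiableOn_const 0
    · exact differentiableOn_fst
  · intro z hz l _
    simp [Matrix.det_fin_two_of, inv_mul_cancel₀ (hz0 z hz)]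
  · intro z _
    rfl
  · obtain ⟨⟨-, ha₁⟩, -, hc₀, hc₁⟩ := differentiableOn_coeffs hρ hR hA hB hC
    obtain ⟨ha, hb, hcr⟩ := differentiableOn_remainders hρ hR hA hB hC
    have hsnd : ∀ {f : ℂ → ℂ}, DifferentiableOn ℂ f (Metric.ball 0 ρ) →
        DifferentiableOn ℂ (fun p : ℂ × ℂ => f p.2) (Metric.ball 0 R ×ˢ Metric.ball 0 ρ) :=
      fun hf => hf.comp differentiableOn_snd fun p hp => hp.2
    have hg' := hsnd hg
    have hw : DifferentiableOn ℂ (fun p : ℂ × ℂ => p.1) (Metric.ball 0 R ×ˢ Metric.ball 0 ρ) :=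
      differentiableOn_fst
    have hl : DifferentiableOn ℂ (fun p : ℂ × ℂ => p.2) (Metric.ball 0 R ×ˢ Metric.ball 0 ρ) :=
      differentiableOn_snd
    -- The second witness is `-λ regUpper` with the denominator cleared: `λ⁻¹` occurs only in front
    -- of the remainder of `β`, so it extends holomorphically to `λ = 0`.
    refine ⟨fun p => (expansionAt A B C p.2).regDiag p.1,
      fun p => -((expansionAt A B C p.2).b p.1 +
        p.2 * (2 * (expansionAt A B C p.2).gaugeCoeff * (expansionAt A B C p.2).a p.1 -
          (expansionAt A B C p.2).gaugeCoeff ^ 2 * (expansionAt A B C p.2).c p.1)),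
      fun p => -(expansionAt A B C p.2).gamma p.1, ?_, ?_, ?_, ?_⟩
    · exact (((hsnd ha₁).add (hw.mul ha)).sub (hg'.mul ((hsnd hc₁).add (hw.mul hcr)))).neg
    · exact (hb.add (hl.mul (((hg'.const_mul 2).mul ha).sub ((hg'.pow 2).mul hcr)))).neg
    · exact ((hsnd hc₀).add (hw.mul ((hsnd hc₁).add (hw.mul hcr)))).neg
    · intro w hw hw0 l hl hl0
      obtain ⟨h₃, h₂, h₁⟩ := hpolar l hl hl0
      have key := gauge_potential (hc l hl) hw0 h₁ h₂ h₃
      have hinv : (!![w, (expansionAt A B C l).gaugeCoeff; 0, w⁻¹] : Matrix (Fin 2) (Fin 2) ℂ)⁻¹ =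
          !![w⁻¹, -(expansionAt A B C l).gaugeCoeff; 0, w] := by
        rw [Matrix.inv_def, Matrix.det_fin_two_of, mul_inv_cancel₀ hw0, Matrix.adjugate_fin_two_of]
        simp
      have hder : (Matrix.of fun i j => deriv (fun z' : ℂ =>
          (!![z'⁻¹, (expansionAt A B C l).gaugeCoeff; 0, z'] : Matrix (Fin 2) (Fin 2) ℂ) i j) w⁻¹) =
          !![-w ^ 2, 0; 0, 1] := by
        ext i j
        fin_cases i <;> fin_cases j <;> simp
      rw [coeffAtInfty, gaugeAction, hξ w hw hw0 l hl, inv_inv, hinv, hder, key]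
      ext i j
      fin_cases i <;> fin_cases j <;> simp [regUpper]
      field_simp
      ring

end Family

/-! ### Vanishing of the polar part for small `t` -/

theorem eventually_forall_norm_sub_lt {E : Type*} [NormedAddCommGroup E] {ε : ℝ} (hε : 0 < ε)
    {S K : Set ℂ} (hS : IsOpen S) (hK : IsCompact K) (hKS : K ⊆ S) {f : ℝ → ℂ → E}
    (hf : ContinuousOn (fun p : ℝ × ℂ => f p.1 p.2) (Ioo (-ε) ε ×ˢ S)) {δ : ℝ} (hδ : 0 < δ) :
    ∀ᶠ t in 𝓝 (0 : ℝ), ∀ z ∈ K, ‖f t z - f 0 z‖ < δ := by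
  refine hK.eventually_forall_of_forall_eventually fun z hz => ?_
  have h0 : (0 : ℝ) ∈ Ioo (-ε) ε := ⟨by linarith, hε⟩
  have hn : ∀ {t : ℝ} {v : ℂ}, t ∈ Ioo (-ε) ε → v ∈ S → Ioo (-ε) ε ×ˢ S ∈ 𝓝 (t, v) :=
    fun ht hv => (isOpen_Ioo.prod hS).mem_nhds ⟨ht, hv⟩
  have h1 : ContinuousAt (fun p : ℝ × ℂ => f p.1 p.2) (0, z) :=
    hf.continuousAt (hn h0 (hKS hz))
  have h2 : ContinuousAt (fun p : ℝ × ℂ => f 0 p.2) (0, z) :=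
    ContinuousAt.comp (g := fun p : ℝ × ℂ => f p.1 p.2) (f := fun p : ℝ × ℂ => ((0 : ℝ), p.2)) h1
      (by fun_prop)
  have h3 := (h1.sub h2).norm
  exact h3.eventually (gt_mem_nhds (by simpa using hδ))

theorem isOpen_puncturedDiscInfty (R : ℝ) : IsOpen (puncturedDiscInfty R) :=
  isOpen_lt continuous_const continuous_norm

theorem isOpen_coverInfty (R : ℝ) : IsOpen (coverInfty R) :=
  isOpen_lt continuous_const Complex.continuous_re

theorem norm_exp_neg_lt_of_mem_coverInfty {R : ℝ} (hR : 0 < R) {ζ : ℂ} (hζ : ζ ∈ coverInfty R) :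
    ‖Complex.exp (-ζ)‖ < R := by
  rw [Complex.norm_exp, Complex.neg_re, ← Real.lt_log_iff_exp_lt hR]
  linarith [show -Real.log R < ζ.re from hζ]

/-- The trace-free part of a matrix function that is `± 1` with vanishing derivative at a point. -/
theorem traceFree_isLittleO {M : ℂ → Matrix (Fin 2) (Fin 2) ℂ} (h1 : M 1 = 1 ∨ M 1 = -1)
    (hd : ∀ i j, HasDerivAt (fun l => M l i j) 0 1) :
    (fun l => ‖traceFree (M l)‖) =o[𝓝 1] fun l => l - 1 := by
  have hM : HasDerivAt M 0 1 := hasDerivAt_matrix_two hd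
  have ho := hasDerivAt_iff_isLittleO.1 hM
  simp only [smul_zero, sub_zero] at ho
  refine (Asymptotics.IsBigO.of_bound 2 (Eventually.of_forall fun l => ?_)).trans_isLittleO ho
  have h2 : traceFree (M l) = traceFree (M l - M 1) := by
    rcases h1 with h | h <;> rw [h, traceFree_eq, traceFree_eq] <;> simp
  rw [norm_norm, h2]
  exact norm_traceFree_le _

section Family

variable {ρ R : ℝ}

theorem evalNonneg_eq_of_loopMatrix_eq (hρ : 1 < ρ) {a b c : Wiener ρ} (ha : a.IsNonneg)
    (hb : b.IsNonneg) (hc : c.IsNonneg)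
    (h : ∀ l : ℂ, ‖l‖ = 1 → loopMatrix a b c l = !![0, 0; 1, 0]) {l : ℂ} (hl : ‖l‖ < ρ) :
    evalNonneg ρ l a = 0 ∧ evalNonneg ρ l b = 0 ∧ evalNonneg ρ l c = 1 := by
  have hd := fun f : Wiener ρ => differentiableOn_evalNonneg_apply hρ f
  have hlt : ∀ {l : ℂ}, ‖l‖ = 1 → ‖l‖ < ρ := fun h => h.trans_lt hρ
  have hl' : l ∈ Metric.ball (0 : ℂ) ρ := mem_ball_zero_iff.2 hl
  refine ⟨eqOn_ball_of_eqOn_unitCircle hρ (hd a) (differentiableOn_const 0) (fun l hl => ?_) hl',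
    eqOn_ball_of_eqOn_unitCircle hρ (hd b) (differentiableOn_const 0) (fun l hl => ?_) hl',
    eqOn_ball_of_eqOn_unitCircle hρ (hd c) (differentiableOn_const 1) (fun l hl => ?_) hl'⟩
  · rw [← ha.eval_eq hρ (hlt hl)]
    simpa [loopMatrix] using congrFun (congrFun (h l hl) 0) 0
  · rw [← hb.eval_eq hρ (hlt hl)]
    have hl0 : l ≠ 0 := norm_pos_iff.1 (by rw [hl]; norm_num)
    simpa [loopMatrix, hl0] using congrFun (congrFun (h l hl) 0) 1
  · rw [← hc.eval_eq hρ (hlt hl)]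
    simpa [loopMatrix] using congrFun (congrFun (h l hl) 1) 0

variable {A B C : ℂ → Wiener ρ}

/-- The polar part of the gauged potential vanishes if the monodromy is unitary and the residue
conditions are satisfied. -/
theorem polar_eq_zero (hρ : 1 < ρ) (hR : 0 < R)
    (hA : DifferentiableOn ℂ A (Metric.ball 0 R)) (hB : DifferentiableOn ℂ B (Metric.ball 0 R))
    (hC : DifferentiableOn ℂ C (Metric.ball 0 R))
    (hc : ∀ l ∈ Metric.ball (0 : ℂ) ρ, (expansionAt A B C l).c₀ ≠ 0)
    {M : ℂ → Matrix (Fin 2) (Fin 2) ℂ} (hM1 : M 1 = 1 ∨ M 1 = -1)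
    (hMd : ∀ i j, HasDerivAt (fun l => M l i j) 0 1) {K : ℝ} (hK : 0 < K)
    (hq : ∀ l : ℂ, ‖l‖ = 1 → (expansionAt A B C l).polarNorm l ^ 2 ≤
      K * ((expansionAt A B C l).polar₂ l ^ 2 -
        (expansionAt A B C l).polar₃ l * (expansionAt A B C l).polar₁ l).re)
    (hqM : ∀ l : ℂ, ‖l‖ = 1 → (expansionAt A B C l).polarNorm l ≤ K * ‖traceFree (M l)‖)
    (h0 : (B 0).coeff 0 = 0) (h1 : ((dslope B 0 0).coeff 0).re = 0) :
    ∀ l ∈ Metric.ball (0 : ℂ) ρ, l ≠ 0 → (expansionAt A B C l).polar₃ l = 0 ∧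
      (expansionAt A B C l).polar₂ l = 0 ∧ (expansionAt A B C l).polar₁ l = 0 := by
  have hg := differentiableOn_gaugeCoeff hρ hR hA hB hC hc
  obtain ⟨⟨ha₀, ha₁⟩, ⟨hb₀, hb₁, hb₂⟩, -, hc₁⟩ := differentiableOn_coeffs hρ hR hA hB hC
  set J := expansionAt A B C with hJ
  -- The polar coefficients times `λ`, now holomorphic at `λ = 0`. There the gauge corrections
  -- disappear, so `x` and `y` reduce to Taylor coefficients of `β⁰`, which the residue conditions
  -- constrain.
  set x : ℂ → ℂ := fun l => (J l).b₀ with hx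
  set y : ℂ → ℂ := fun l => (J l).b₁ + l * ((J l).gaugeCoeff * (J l).a₀) with hy
  set z : ℂ → ℂ := fun l => (J l).b₂ + l * (2 * (J l).gaugeCoeff * (J l).a₁ -
    (J l).gaugeCoeff ^ 2 * (J l).c₁) with hz
  have hxl : ∀ l : ℂ, l ≠ 0 → (J l).polar₃ l = l⁻¹ * x l := fun l _ => rfl
  have hyl : ∀ l : ℂ, l ≠ 0 → (J l).polar₂ l = l⁻¹ * y l := fun l hl => by
    rw [polar₂, hy]; field_simp
  have hzl : ∀ l : ℂ, l ≠ 0 → (J l).polar₁ l = l⁻¹ * z l := fun l hl => by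
    rw [polar₁, hz]; field_simp; ring
  have hne : ∀ l : ℂ, ‖l‖ = 1 → l ≠ 0 := fun l hl => norm_pos_iff.1 (by rw [hl]; norm_num)
  have hnorm : ∀ l : ℂ, ‖l‖ = 1 → (J l).polarNorm l = ‖x l‖ + ‖y l‖ + ‖z l‖ := fun l hl => by
    rw [polarNorm, hxl l (hne l hl), hyl l (hne l hl), hzl l (hne l hl)]
    simp [hl]
  have hlittle : ∀ f : ℂ → ℂ, (∀ l : ℂ, ‖l‖ = 1 → ‖f l‖ ≤ ‖x l‖ + ‖y l‖ + ‖z l‖) →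
      f =o[𝓝[Metric.sphere 0 1] 1] fun l => l - 1 := by
    intro f hf
    refine (Asymptotics.IsBigO.of_bound K ?_).trans_isLittleO
      ((traceFree_isLittleO hM1 hMd).mono nhdsWithin_le_nhds)
    filter_upwards [self_mem_nhdsWithin] with l hl
    have hl' : ‖l‖ = 1 := by simpa using hl
    rw [norm_norm]
    exact (hf l hl').trans ((hnorm l hl').symm.trans_le (hqM l hl'))
  have hb00 : x 0 = 0 := by
    change evalNonneg ρ 0 (B 0) = 0
    rw [evalNonneg_zero hρ, h0]
  have hb10 : y 0 = (dslope B 0 0).coeff 0 := by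
    have : (J 0).b₁ = evalNonneg ρ 0 (dslope B 0 0) :=
      congrFun (dslope_evalNonneg_comp hR hB 0) 0
    simp only [hy, zero_mul, add_zero]
    rw [this, evalNonneg_zero hρ]
  have key := eqOn_zero_of_quadratic_coercive hρ (x := x) (y := y) (z := z) hK hb₀
    (hb₁.add (differentiableOn_id.mul (hg.mul ha₀)))
    (hb₂.add (differentiableOn_id.mul (((hg.const_mul 2).mul ha₁).sub ((hg.pow 2).mul hc₁))))
    (hlittle x fun l _ => by linarith [norm_nonneg (y l), norm_nonneg (z l)])
    (hlittle y fun l _ => by linarith [norm_nonneg (x l), norm_nonneg (z l)])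
    (hlittle z fun l _ => by linarith [norm_nonneg (x l), norm_nonneg (y l)])
    (fun l hl => by
      have := hq l hl
      rwa [hnorm l hl, hxl l (hne l hl), hyl l (hne l hl), hzl l (hne l hl)] at this)
    (by
      rw [hb00, hb10, zero_mul, sub_zero, sq, Complex.mul_re, h1]
      nlinarith [sq_nonneg ((dslope B 0 0).coeff 0).im])
  intro l hl hl0
  obtain ⟨k1, k2, k3⟩ := key l hl
  exact ⟨by rw [hxl l hl0, k1, mul_zero], by rw [hyl l hl0, k2, mul_zero],
    by rw [hzl l hl0, k3, mul_zero]⟩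

/-- With `w = z⁻¹`, the form `w B(w) dz` has `z⁻¹`-coefficient `B(0)`; multiplication by `z` shifts
the expansion, so the next Taylor coefficient of `B` appears. -/
theorem resInfty_coeff_eq (hR : 0 < R) {f : ℂ → Wiener ρ}
    (hB : DifferentiableOn ℂ B (Metric.ball 0 R)) (hf : ∀ w ≠ 0, f w⁻¹ = w • B w) :
    resInfty (fun z => (f z).coeff 0) = -(B 0).coeff 0 ∧
      resInfty (fun z => z * (f z).coeff 0) = -(dslope B 0 0).coeff 0 := by
  have hz0 : ∀ z ∈ puncturedDiscInfty R, z ≠ 0 := fun z hz =>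
    norm_pos_iff.1 ((inv_pos.2 hR).trans hz)
  have hB1 := hB.dslope_zero hR
  have hB2 := hB1.dslope_zero hR
  have hfz : ∀ z ≠ 0, (f z).coeff 0 = z⁻¹ * (B z⁻¹).coeff 0 := by
    intro z hz
    have h1 := hf z⁻¹ (inv_ne_zero hz)
    rw [inv_inv] at h1
    rw [h1]
    exact (coeffCLM ρ 0).map_smul z⁻¹ (B z⁻¹)
  have hexp : ∀ (D : ℂ → Wiener ρ) (w : ℂ),
      (D w).coeff 0 = (D 0).coeff 0 + w * (dslope D 0 w).coeff 0 := by
    intro D w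
    have h := congrArg (coeffCLM ρ 0) (eq_add_smul_dslope D w)
    rw [map_add, map_smul] at h
    exact h
  constructor
  · refine resInfty_eq (c := 0) (E := fun w => (dslope B 0 w).coeff 0) hR
      ((coeffCLM ρ 0).differentiable.comp_differentiableOn hB1) fun z hz => ?_
    rw [hfz z (hz0 z hz), hexp B z⁻¹]; ring
  · refine resInfty_eq (c := (B 0).coeff 0) (E := fun w => (dslope (dslope B 0) 0 w).coeff 0) hR
      ((coeffCLM ρ 0).differentiable.comp_differentiableOn hB2) fun z hz => ?_
    rw [hfz z (hz0 z hz), ← mul_assoc, mul_inv_cancel₀ (hz0 z hz), one_mul, hexp B z⁻¹,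
      hexp (dslope B 0) z⁻¹]
    ring

end Family

/-! ### The main theorem -/

theorem mainTheorem4 {ρ R ε : ℝ} (hρ : 1 < ρ) (hR : 0 < R) (hε : 0 < ε)
    (α β γ : ℝ → ℂ → Wiener ρ)
    (Φ : ℝ → ℂ → Matrix (Fin 2) (Fin 2) (Wiener ρ))
    (ζ₀ : ℂ) (hζ₀ : ζ₀ ∈ coverInfty R)
    (hξ : IsC1PotentialFamily ε (puncturedDiscInfty R) α β γ)
    (hα_pole : ∀ t ∈ Ioo (-ε) ε, HasPoleAtInftyLE 1 (α t))
    (hβ_pole : ∀ t ∈ Ioo (-ε) ε, HasPoleAtInftyLE 1 (β t))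
    (hγ_pole : ∀ t ∈ Ioo (-ε) ε, HasPoleAtInftyLE 2 (γ t))
    (hξ_zero : ∀ z ∈ puncturedDiscInfty R, ∀ l : ℂ, ‖l‖ = 1 →
      loopMatrix (α 0 z) (β 0 z) (γ 0 z) l = !![0, 0; 1, 0])
    (hΦ : IsC1SolutionFamily ε R α β γ Φ)
    (hΦ_zero : ∃ ρ' : ℝ, ρ < ρ' ∧ ∃ F : ℂ → Matrix (Fin 2) (Fin 2) ℂ,
      (∀ i j, DifferentiableOn ℂ (fun l => F l i j) (loopAnnulus ρ')) ∧
      ∀ l : ℂ, ‖l‖ = 1 → F l = Wiener.evalMatrix (Φ 0 ζ₀) l)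
    (hmonodromy : ∀ t ∈ Ioo (-ε) ε, SolvesMonodromyProblem (Φ t) ζ₀)
    (hres : ∀ t ∈ Ioo (-ε) ε, resInfty (fun z => (β t z).coeff 0) = 0)
    (hres_re : ∀ t ∈ Ioo (-ε) ε, (resInfty (fun z => z * (β t z).coeff 0)).re = 0) :
    ∀ᶠ t in 𝓝 (0 : ℝ), ∃ G : ℂ → ℂ → Matrix (Fin 2) (Fin 2) ℂ,
      IsGauge ρ (puncturedDiscInfty R) G ∧
      ExtendsHolomorphicallyAtInfty ρ
        (gaugeAction (fun z l => loopMatrix (α t z) (β t z) (γ t z) l) G) := by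
  have ht0 : (0 : ℝ) ∈ Ioo (-ε) ε := ⟨by linarith, hε⟩
  -- The loop through the base point is the circle `|w| = |exp (-ζ₀)|`; it must lie inside the disc
  -- of radius `r` on which the regular part is small.
  obtain ⟨r, hsr, hrR⟩ := exists_between (norm_exp_neg_lt_of_mem_coverInfty hR hζ₀)
  have hr : 0 < r := (norm_nonneg _).trans_lt hsr
  set φ := ∑ i, ∑ j, ‖Φ 0 ζ₀ i j‖ + 1
  obtain ⟨δ₀, hδ₀, hδ₀', K, hK, hmain⟩ := polarNorm_sq_le_of_monodromy (φ := φ) hsr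
  set m := (1 + 2 / r) ^ 3 with hm
  have hm0 : 0 < m := by positivity
  set δ := δ₀ / m with hδ
  have hδpos : 0 < δ := by positivity
  have hmδ : m * δ = δ₀ := mul_div_cancel₀ _ hm0.ne'
  -- `A` and `B` arise from `α` and `β` by division by `w`, of modulus `r` on the circle, whereas
  -- `C` is `γ` itself.
  set δ' := min δ (δ * r) with hδ'
  have hδ'pos : 0 < δ' := lt_min hδpos (by positivity)
  have hsphere : Metric.sphere (0 : ℂ) r⁻¹ ⊆ puncturedDiscInfty R := fun z hz => by
    have : ‖z‖ = r⁻¹ := by simpa using hz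
    simp only [puncturedDiscInfty, mem_ofPred_eq, this]
    exact inv_strictAnti₀ hr hrR
  have hS := isOpen_puncturedDiscInfty R
  have hcpt := isCompact_sphere (0 : ℂ) r⁻¹
  have hΦev : ∀ᶠ t in 𝓝 (0 : ℝ), ∀ i j, ‖Φ t ζ₀ i j‖ ≤ φ := by
    simp only [eventually_all]
    intro i j
    have h1 := eventually_forall_norm_sub_lt (f := fun t z => Φ t z i j) hε (isOpen_coverInfty R)
      (isCompact_singleton (x := ζ₀)) (singleton_subset_iff.2 hζ₀) (hΦ.contDiff i j).continuousOn
      one_pos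
    filter_upwards [h1] with t ht
    have h2 : ‖Φ 0 ζ₀ i j‖ ≤ ∑ i, ∑ j, ‖Φ 0 ζ₀ i j‖ :=
      (Finset.single_le_sum (f := fun j => ‖Φ 0 ζ₀ i j‖) (fun _ _ => norm_nonneg _)
        (Finset.mem_univ j)).trans
        (Finset.single_le_sum (f := fun i => ∑ j, ‖Φ 0 ζ₀ i j‖)
          (fun _ _ => Finset.sum_nonneg fun _ _ => norm_nonneg _) (Finset.mem_univ i))
    have h3 := norm_sub_norm_le (Φ t ζ₀ i j) (Φ 0 ζ₀ i j)
    have h4 := ht ζ₀ (mem_singleton ζ₀)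
    change _ ≤ ∑ i, ∑ j, ‖Φ 0 ζ₀ i j‖ + 1
    linarith
  filter_upwards [isOpen_Ioo.mem_nhds ht0, hΦev,
    eventually_forall_norm_sub_lt hε hS hcpt hsphere hξ.contDiff_α.continuousOn hδ'pos,
    eventually_forall_norm_sub_lt hε hS hcpt hsphere hξ.contDiff_β.continuousOn hδ'pos,
    eventually_forall_norm_sub_lt hε hS hcpt hsphere hξ.contDiff_γ.continuousOn hδ'pos]
    with t ht hΦt hαt hβt hγt
  obtain ⟨A, hA, hAα⟩ := (hα_pole t ht).exists_eq_smul (by norm_num) hR (hξ.holomorphic_α t ht)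
  obtain ⟨B, hB, hBβ⟩ := (hβ_pole t ht).exists_eq_smul (by norm_num) hR (hξ.holomorphic_β t ht)
  obtain ⟨C, hC, hCγ⟩ := (hγ_pole t ht).exists_eq_smul (by norm_num) hR (hξ.holomorphic_γ t ht)
  simp only [Nat.add_one_sub_one, pow_one, Nat.reduceSub, pow_zero, one_smul] at hAα hBβ hCγ
  have hpot : ∀ w ∈ Metric.ball (0 : ℂ) R, w ≠ 0 → ∀ l ∈ Metric.ball (0 : ℂ) ρ,
      loopMatrix (α t w⁻¹) (β t w⁻¹) (γ t w⁻¹) l = (expansionAt A B C l).potential l w := by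
    intro w hw hw0 l hl
    have hw' := inv_mem_puncturedDiscInfty hw hw0
    exact loopMatrix_eq_potential hρ (hξ.nonneg_α t ht _ hw') (hξ.nonneg_β t ht _ hw')
      (hξ.nonneg_γ t ht _ hw') (hAα w hw0) (hBβ w hw0) (hCγ w hw0) (mem_ball_zero_iff.1 hl)
  have hclose : ∀ l ∈ Metric.ball (0 : ℂ) ρ, (expansionAt A B C l).IsClose r δ₀ := by
    intro l hl
    have hl' : ‖l‖ < ρ := mem_ball_zero_iff.1 hl
    have hsub : ∀ {f g : Wiener ρ}, ‖f - g‖ < δ' → ‖evalNonneg ρ l f - evalNonneg ρ l g‖ ≤ δ' :=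
      fun h => by
        rw [← map_sub]; exact (norm_evalNonneg_apply_le hρ hl' _).trans h.le
    have hzero : ∀ z ∈ Metric.sphere (0 : ℂ) r⁻¹, _ := fun z hz =>
      evalNonneg_eq_of_loopMatrix_eq hρ (hξ.nonneg_α 0 ht0 z (hsphere hz))
        (hξ.nonneg_β 0 ht0 z (hsphere hz)) (hξ.nonneg_γ 0 ht0 z (hsphere hz))
        (hξ_zero z (hsphere hz)) hl'
    have hw : ∀ w ∈ Metric.sphere (0 : ℂ) r,
        ‖w‖ = r ∧ w ≠ 0 ∧ w⁻¹ ∈ Metric.sphere (0 : ℂ) r⁻¹ := by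
      intro w hw
      have : ‖w‖ = r := by simpa using hw
      exact ⟨this, norm_pos_iff.1 (this ▸ hr), by simp [this]⟩
    have hdiv : ∀ {w : ℂ} {f : Wiener ρ}, ‖w‖ = r → ‖evalNonneg ρ l (w • f)‖ ≤ δ' →
        ‖evalNonneg ρ l f‖ ≤ δ := by
      intro w f hw h
      rw [map_smul, norm_smul, hw] at h
      refine le_of_mul_le_mul_left (h.trans ((min_le_right _ _).trans_eq (mul_comm _ _))) hr
    rw [← hmδ]
    have hd : ∀ {D : ℂ → Wiener ρ}, DifferentiableOn ℂ D (Metric.ball 0 R) →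
        DifferentiableOn ℂ (evalNonneg ρ l ∘ D) (Metric.ball 0 R) := fun h =>
      (evalNonneg ρ l).differentiable.comp_differentiableOn h
    refine isClose_ofFunctions hr hrR (hd hA) (hd hB) (hd hC) ?_ ?_ ?_
    · intro w hws
      obtain ⟨h1, h2, h3⟩ := hw w hws
      have h4 := hsub (hαt _ h3)
      rw [(hzero _ h3).1, sub_zero, hAα w h2] at h4
      exact hdiv h1 h4
    · intro w hws
      obtain ⟨h1, h2, h3⟩ := hw w hws
      have h4 := hsub (hβt _ h3)
      rw [(hzero _ h3).2.1, sub_zero, hBβ w h2] at h4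
      exact hdiv h1 h4
    · intro w hws
      obtain ⟨h1, h2, h3⟩ := hw w hws
      have h4 := hsub (hγt _ h3)
      rw [(hzero _ h3).2.2, hCγ w h2] at h4
      exact h4.trans (min_le_left _ _)
  have hc : ∀ l ∈ Metric.ball (0 : ℂ) ρ, (expansionAt A B C l).c₀ ≠ 0 :=
    fun l hl => (hclose l hl).c₀_ne_zero hδ₀'
  obtain ⟨hres₀, hres₁⟩ := resInfty_coeff_eq hR hB hBβ
  have hM := hmonodromy t ht
  have hann : ∀ l : ℂ, ‖l‖ = 1 → l ∈ loopAnnulus ρ := fun l hl => by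
    simp only [loopAnnulus, mem_ofPred_eq, hl]
    exact ⟨inv_lt_one_of_one_lt₀ hρ, hρ⟩
  have hest := fun (l : ℂ) (hl : ‖l‖ = 1) =>
    hmain (expansionAt A B C l) l (fun ζ => evalMatrix (Φ t ζ) l) hl
      (hclose l (mem_ball_of_norm_eq_one hρ hl)) (hΦ.det_eq_one t ht ζ₀ hζ₀ l (hann l hl))
      (fun i j => (norm_eval_le hρ _ hl).trans (hΦt i j))
      (fun ζ hζ i j => by
        have hζ' : ζ ∈ coverInfty R := by
          change -Real.log R < ζ.re
          rw [hζ]; exact hζ₀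
        have h1 := hΦ.hasDerivAt t ht ζ hζ' l (hann l hl) i j
        have h2 := hpot (Complex.exp (-ζ))
          (mem_ball_zero_iff.2 (norm_exp_neg_lt_of_mem_coverInfty hR hζ')) (Complex.exp_ne_zero _) l
          (mem_ball_of_norm_eq_one hρ hl)
        rw [Complex.exp_neg, inv_inv, ← Complex.exp_neg] at h2
        rw [h2] at h1
        exact h1)
      (hM.unitary l hl)
  have hpolar := polar_eq_zero hρ hR hA hB hC hc (M := monodromy (Φ t) ζ₀) hM.at_one
    hM.deriv_at_one hK (fun l hl => (hest l hl).1) (fun l hl => (hest l hl).2)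
    (by rw [← neg_eq_zero, ← hres₀]; exact hres t ht)
    (by
      have := hres_re t ht
      rwa [hres₁, Complex.neg_re, neg_eq_zero] at this)
  exact exists_gauge_of_polar_eq_zero hρ hR hA hB hC hc hpolar
    (ξ := fun z l => loopMatrix (α t z) (β t z) (γ t z) l) hpot

end
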